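/- For real $\delta=(\delta_1,\delta_2,\delta_3)$ and $y=(x,s,h,r)$ put $t=\delta_1/2$ and $v_{1,2}=(\pm r,0,-t)$, $v_{3,4}=(0,\pm r,t)$, $v_5=(h,x,s)$, $v_6=(-h,x,s)$, $v_7=(h,-x,s)$, $v_8=(-h,-x,s)$, $v_9=(x,h,-s)$, $v_{10}=(x,-h,-s)$, $v_{11}=(-x,h,-s)$, $v_{12}=(-x,-h,-s)$, where the upper sign belongs to the first index. Let $P_{\delta,y}\subset\mathbb R^3$ be the convex hull of $v_1,\dots,v_{12}$, and let $n_1=(v_{11}-v_3)\times(v_{12}-v_3)$, $n_2=(v_8-v_2)\times(v_{12}-v_2)$, $n_4=(v_1-v_5)\times(v_4-v_8)$, $n_5=(v_1-v_9)\times(v_4-v_8)$. A convex body (a compact convex set with non-empty interior) is called reduced if each convex body properly contained in it has strictly smaller minimum width. A facet of a polytope in $\mathbb R^3$ is a two-dimensional face; a vertex $v$ and a facet $F$ of a polytope $P$ are strictly antipodal if, for some unit vector $u$, the two supporting planes of $P$ with outer normals $u$ and $-u$ meet $P$ exactly in $\{v\}$ and in $F$. Let $\rho(A,B)$ denote the distance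 between the affine hulls of $A$ and $B$. Then there exist reduced polytopes in three-dimensional Euclidean space. More precisely, for every $\delta$ the four expressions $$h^{-2}\bigl(\langle n_1,v_1-v_3\rangle^2-\|n_1\|^2\bigr),\qquad \langle n_2,v_5-v_2\rangle^2-\|n_2\|^2,$$ $$(h+r-x)^{-2}\bigl(\langle n_5,v_1-v_4\rangle^2-\delta_3^2\|n_5\|^2\bigr),\qquad \langle n_4,v_1-v_4\rangle^2-\delta_2^2\|n_4\|^2$$ are polynomials of total degree at most $6$ in $(x,s,h,r)$, and there are an open neighbourhood $U$ of $\delta^0=(1.1,\,1.003,\,1.004)$ in $\mathbb R^3$ and a $C^\infty$ map $\varphi:U\to\mathbb R^4$ with the following properties. (a) The coordinates of $\varphi(\delta^0)$ differ by at most $10^{-13}$ from $x=0.6176490959800$, $s=0.1351384931026$, $h=0.0984300252409$, $r=0.3547183586709$, and at this point the Jacobian of the four polynomials (for $\delta=\delta^0$) with respect to $(x,s,h,r)$ is invertible. (b) For every $\delta\in U$, the point $(x,s,h,r)=\varphi(\delta)$ is an exact common root of the four polynomials, and $t,x,s,h,r>0$. The polytope $P=P_{\delta,\varphi(\delta)}$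 has exactly twelve vertices, namely the distinct points $v_1,\dots,v_{12}$. Moreover $\rho(v_1,v_3v_{11}v_{12}v_4)=\rho(v_5,v_2v_8v_{12})=1$, $\rho(v_1v_2,v_3v_4)=\delta_1$, $\rho(v_1v_5,v_4v_8)=\delta_2$ and $\rho(v_1v_9,v_4v_8)=\delta_3$, where a list of points stands for the set of these points. The symmetry group of $P$ is the group $D_{2d}$ of order $8$ (the symmetry group of the Johnson solid $J_{84}$) that consists of the maps $(a,b,c)\mapsto(\pm a,\pm b,c)$ and $(a,b,c)\mapsto(\pm b,\pm a,-c)$. The minimum width of $P$ is $1$, each vertex $v_k$ has a strictly antipodal facet $F$ with $\rho(v_k,F)=1$, and $P$ is reduced. (c) The family has three degrees of freedom: for distinct $\delta,\delta'\in U$ the polytopes $P_{\delta,\varphi(\delta)}$ and $P_{\delta',\varphi(\delta')}$ are not congruent. -/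

import Mathlib

open scoped ContDiff

noncomputable section

namespace ReducedPolytope

/-- `d`-dimensional Euclidean space. -/
abbrev E (d : ℕ) : Type := EuclideanSpace ℝ (Fin d)

section General

variable {d : ℕ}

/-- The support function `h(K, u) = sup {⟪u, x⟫ | x ∈ K}`. -/
def supportFn (K : Set (E d)) (u : E d) : ℝ :=
  sSup {a : ℝ | ∃ x ∈ K, a = inner ℝ u x}

/-- The supporting hyperplane `H(K, u)` (used for `u ≠ 0`). -/
def supportHyperplane (K : Set (E d)) (u : E d) : Set (E d) :=
  {x | inner ℝ u x = supportFn K u}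

/-- The width of `K` in direction `u`. -/
def width (K : Set (E d)) (u : E d) : ℝ :=
  supportFn K (-u) + supportFn K u

/-- The minimum width `ω(K)`. -/
def minWidth (K : Set (E d)) : ℝ :=
  sInf {w : ℝ | ∃ u : E d, ‖u‖ = 1 ∧ w = width K u}

/-- Convex bodies: compact convex sets with non-empty interior. -/
structure IsConvexBody (K : Set (E d)) : Prop where
  convex : Convex ℝ K
  isCompact : IsCompact K
  nonempty_interior : (interior K).Nonempty

/-- A convex body is reduced if every convex body properly contained in it has
strictly smaller minimum width. -/
structure IsReduced (K : Set (E d)) : Prop where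
  isConvexBody : IsConvexBody K
  minWidth_lt : ∀ K' : Set (E d), IsConvexBody K' → K' ⊂ K → minWidth K' < minWidth K

/-- A polytope is the convex hull of finitely many points. -/
def IsPolytope (P : Set (E d)) : Prop :=
  ∃ S : Set (E d), S.Finite ∧ P = convexHull ℝ S

/-- Faces: intersections of `P` with its supporting hyperplanes. -/
def IsFace (P F : Set (E d)) : Prop :=
  ∃ u : E d, u ≠ 0 ∧ F = supportHyperplane P u ∩ P

/-- The affine dimension of a (non-empty) set. -/
def affDim (F : Set (E d)) : ℕ := Module.finrank ℝ (vectorSpan ℝ F)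

/-- `x` is a vertex of `P`, i.e. `{x}` is a face of dimension `0`. -/
def IsVertex (P : Set (E d)) (x : E d) : Prop := IsFace P {x}

/-- Facets: faces of affine dimension `d - 1`. -/
def IsFacet (P F : Set (E d)) : Prop := IsFace P F ∧ affDim F + 1 = d

/-- Strict antipodality of two distinct faces. -/
def StrictlyAntipodal (P F₁ F₂ : Set (E d)) : Prop :=
  IsFace P F₁ ∧ IsFace P F₂ ∧ F₁ ≠ F₂ ∧
    ∃ u : E d, ‖u‖ = 1 ∧
      supportHyperplane P u ∩ P = F₁ ∧ supportHyperplane P (-u) ∩ P = F₂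

/-- `ρ(A, B)`: the distance between the affine hulls of `A` and `B`. -/
def rho (A B : Set (E d)) : ℝ :=
  sInf {a : ℝ | ∃ x ∈ affineSpan ℝ A, ∃ y ∈ affineSpan ℝ B, a = ‖x - y‖}

/-- Two sets are congruent if an isometry of the space maps one onto the other. -/
def Congruent (A B : Set (E d)) : Prop := ∃ f : E d ≃ᵢ E d, f '' A = B

end General

/-- The cross product on `ℝ³`. -/
def cross (u w : E 3) : E 3 := WithLp.toLp 2 (crossProduct u.ofLp w.ofLp)

/-- The twelve points; `pts t x s h r i` is the point usually called `v_{i+1}`. -/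
def pts (t x s h r : ℝ) : Fin 12 → E 3 :=
  ![!₂[ r,  0, -t], !₂[-r,  0, -t], !₂[ 0,  r,  t], !₂[ 0, -r,  t],
    !₂[ h,  x,  s], !₂[-h,  x,  s], !₂[ h, -x,  s], !₂[-h, -x,  s],
    !₂[ x,  h, -s], !₂[ x, -h, -s], !₂[-x,  h, -s], !₂[-x, -h, -s]]

/-- The points `v₁, …, v₁₂` for given `δ = (δ₁, δ₂, δ₃)` and `y = (x, s, h, r)`,
where `t = δ₁ / 2`. The index is the usual one, `v δ y k = v_k` for `1 ≤ k ≤ 12`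
(other values of `k` are not used). -/
def v (δ : Fin 3 → ℝ) (y : Fin 4 → ℝ) (k : ℕ) : E 3 :=
  pts (δ 0 / 2) (y 0) (y 1) (y 2) (y 3) (Fin.ofNat 12 (k - 1))

/-- The polytope `P = conv {v₁, …, v₁₂}`. -/
def poly (δ : Fin 3 → ℝ) (y : Fin 4 → ℝ) : Set (E 3) :=
  convexHull ℝ (v δ y '' Set.Icc 1 12)

def n₁ (δ : Fin 3 → ℝ) (y : Fin 4 → ℝ) : E 3 :=
  cross (v δ y 11 - v δ y 3) (v δ y 12 - v δ y 3)

def n₂ (δ : Fin 3 → ℝ) (y : Fin 4 → ℝ) : E 3 :=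
  cross (v δ y 8 - v δ y 2) (v δ y 12 - v δ y 2)

def n₄ (δ : Fin 3 → ℝ) (y : Fin 4 → ℝ) : E 3 :=
  cross (v δ y 1 - v δ y 5) (v δ y 4 - v δ y 8)

def n₅ (δ : Fin 3 → ℝ) (y : Fin 4 → ℝ) : E 3 :=
  cross (v δ y 1 - v δ y 9) (v δ y 4 - v δ y 8)

/-- `q` is the system of the four polynomials in the unknowns `(x, s, h, r)`
  `h⁻² (⟪n₁, v₁ - v₃⟫² - ‖n₁‖²)`, `⟪n₂, v₅ - v₂⟫² - ‖n₂‖²`,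
  `(h + r - x)⁻² (⟪n₅, v₁ - v₄⟫² - δ₃² ‖n₅‖²)`, `⟪n₄, v₁ - v₄⟫² - δ₂² ‖n₄‖²`,
under `t = δ₁ / 2`. (Each polynomial is determined by the corresponding identity.) -/
structure IsSystem (δ : Fin 3 → ℝ) (q : Fin 4 → MvPolynomial (Fin 4) ℝ) : Prop where
  eq₁ : ∀ y : Fin 4 → ℝ, (y 2) ^ 2 * MvPolynomial.eval y (q 0) =
    (inner ℝ (n₁ δ y) (v δ y 1 - v δ y 3)) ^ 2 - ‖n₁ δ y‖ ^ 2
  eq₂ : ∀ y : Fin 4 → ℝ, MvPolynomial.eval y (q 1) =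
    (inner ℝ (n₂ δ y) (v δ y 5 - v δ y 2)) ^ 2 - ‖n₂ δ y‖ ^ 2
  eq₃ : ∀ y : Fin 4 → ℝ, (y 2 + y 3 - y 0) ^ 2 * MvPolynomial.eval y (q 2) =
    (inner ℝ (n₅ δ y) (v δ y 1 - v δ y 4)) ^ 2 - (δ 2) ^ 2 * ‖n₅ δ y‖ ^ 2
  eq₄ : ∀ y : Fin 4 → ℝ, MvPolynomial.eval y (q 3) =
    (inner ℝ (n₄ δ y) (v δ y 1 - v δ y 4)) ^ 2 - (δ 1) ^ 2 * ‖n₄ δ y‖ ^ 2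

/-- The eight isometries `(a, b, c) ↦ (±a, ±b, c)` and `(a, b, c) ↦ (±b, ±a, -c)`. They form the
group `D_{2d}`, the symmetry group of the Johnson solid `J₈₄` in standard position. -/
def IsD2d (f : E 3 → E 3) : Prop :=
  ∃ ε η : ℝ, (ε = 1 ∨ ε = -1) ∧ (η = 1 ∨ η = -1) ∧
    ((∀ p, f p = !₂[ε * p 0, η * p 1, p 2]) ∨ (∀ p, f p = !₂[ε * p 1, η * p 0, -p 2]))

/-- The parameters `δ = (1.1, 1.003, 1.004)`. -/
def δ₀ : Fin 3 → ℝ := ![1.1, 1.003, 1.004]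

/-- The numerical solution `(x, s, h, r)` for `δ₀`. -/
def yNum : Fin 4 → ℝ := ![0.6176490959800, 0.1351384931026, 0.0984300252409, 0.3547183586709]

end ReducedPolytope

end

/-! A polytope is reduced as soon as every vertex v is the unique maximizer of some linear
functional u whose width equals the minimum width: a smaller convex body misses some vertex, and its
support function drops strictly in that direction (`isReduced_of_forall_exists`). Here u is the
normal of a facet at distance one from v. Under D_{2d} the twelve points form two orbits,
represented by v₁ and v₅, so only two distances have to equal one. With the edge distances δ₂ and δ₃
this makes four equations in four unknowns; δ₁ is built in through t.

Multiplied by an approximate inverse of its Jacobian, the system has derivative close to the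
identity on a tiny ball, which yields an exact root (`exists_root`). The Jacobian is invertible
there, so the implicit function theorem extends the root to a smooth family (`exists_smooth_root`).
The strict inequalities about the shape are checked once, by integer interval arithmetic
(`encl_spec`), on a box of radius 10⁻⁹ that contains the family.

For the minimum width one needs ‖u‖ ≤ width(u) for all u. For fixed points x, y of the polytope the
vectors u with ‖u‖ ≤ ⟪u, x - y⟫ form a convex cone, so on a simplicial cone of directions it
suffices to test three generators. Up to D_{2d} and u ↦ -u only a cone covering a sixteenth of the
sphere matters, and it is cut into eight pieces (`Admissible.coneBound`). At facet normals the width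
is exactly one and leaves no numerical slack; these normals are therefore taken as generators, and
the root equations give equality there.

An isometry between two members of the family maps vertices to vertices, hence fixes their common
centroid 0. Norms and inner products single out v₁, …, v₄ and force the isometry into D_{2d}
(`Admissible.isD2d_of_image_eq`). Thus the two vertex sets coincide, and δ can be read off from
them. -/

namespace ReducedPolytope

/-! ### Polynomial expressions, formal derivatives and interval arithmetic -/

/-- Polynomial expressions with integer coefficients in seven variables, standing for
`x, s, h, r, t, δ₂, δ₃`. -/
inductive Ex : Type
  | var (i : Fin 7)
  | cst (c : ℤ)
  | add (a b : Ex)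
  | sub (a b : Ex)
  | mul (a b : Ex)

namespace Ex

instance : Add Ex := ⟨Ex.add⟩
instance : Sub Ex := ⟨Ex.sub⟩
instance : Mul Ex := ⟨Ex.mul⟩
instance (n : ℕ) : OfNat Ex n := ⟨Ex.cst n⟩

/-- The value of an expression. -/
def ev (z : Fin 7 → ℝ) : Ex → ℝ
  | var i => z i
  | cst c => c
  | add a b => ev z a + ev z b
  | sub a b => ev z a - ev z b
  | mul a b => ev z a * ev z b

section

variable (z : Fin 7 → ℝ) (a b : Ex)

@[simp] theorem ev_var (i : Fin 7) : ev z (var i) = z i := rfl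
@[simp] theorem ev_cst (c : ℤ) : ev z (cst c) = c := rfl
@[simp] theorem ev_ofNat (n : ℕ) [n.AtLeastTwo] : ev z ofNat(n) = ofNat(n) := by
  rw [← Nat.cast_ofNat (R := ℝ), ← Int.cast_natCast]
  rfl
@[simp] theorem ev_zero : ev z 0 = 0 := Int.cast_zero
@[simp] theorem ev_one : ev z 1 = 1 := Int.cast_one
@[simp] theorem ev_add : ev z (a + b) = ev z a + ev z b := rfl
@[simp] theorem ev_sub : ev z (a - b) = ev z a - ev z b := rfl
@[simp] theorem ev_mul : ev z (a * b) = ev z a * ev z b := rfl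

end

/-- The expression as a polynomial in `x, s, h, r`, for fixed `δ`. -/
noncomputable def toMv (δ : Fin 3 → ℝ) : Ex → MvPolynomial (Fin 4) ℝ
  | var i => ![.X 0, .X 1, .X 2, .X 3, .C (δ 0 / 2), .C (δ 1), .C (δ 2)] i
  | cst c => .C (c : ℝ)
  | add a b => toMv δ a + toMv δ b
  | sub a b => toMv δ a - toMv δ b
  | mul a b => toMv δ a * toMv δ b

end Ex

/-- The values of the seven variables. -/
noncomputable def env (δ : Fin 3 → ℝ) (y : Fin 4 → ℝ) : Fin 7 → ℝ :=
  ![y 0, y 1, y 2, y 3, δ 0 / 2, δ 1, δ 2]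

namespace Ex

theorem eval_toMv (δ : Fin 3 → ℝ) (y : Fin 4 → ℝ) (e : Ex) :
    MvPolynomial.eval y (toMv δ e) = ev (env δ y) e := by
  induction e with
  | var i => fin_cases i <;> simp [toMv, env]
  | cst c => simp [toMv, ev]
  | add a b iha ihb => simp [toMv, ev, iha, ihb]
  | sub a b iha ihb => simp [toMv, ev, iha, ihb]
  | mul a b iha ihb => simp [toMv, ev, iha, ihb]

/-- The formal partial derivative. -/
def diff (k : Fin 4) : Ex → Ex
  | var i => cst (if i.val = k.val then 1 else 0)
  | cst _ => cst 0
  | add a b => add (diff k a) (diff k b)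
  | sub a b => sub (diff k a) (diff k b)
  | mul a b => add (mul (diff k a) b) (mul a (diff k b))

theorem pderiv_toMv (δ : Fin 3 → ℝ) (k : Fin 4) (e : Ex) :
    MvPolynomial.pderiv k (toMv δ e) = toMv δ (diff k e) := by
  induction e with
  | var i => fin_cases i <;> fin_cases k <;> simp [toMv, diff, MvPolynomial.pderiv_X]
  | cst c => simp only [toMv, diff, MvPolynomial.pderiv_C]; simp
  | add a b iha ihb => simp [toMv, diff, iha, ihb]
  | sub a b iha ihb => simp [toMv, diff, iha, ihb]
  | mul a b iha ihb => simp only [toMv, diff, MvPolynomial.pderiv_mul, iha, ihb]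

/-- A bound for the degree in `x, s, h, r`. -/
def deg : Ex → ℕ
  | var i => if i.val < 4 then 1 else 0
  | cst _ => 0
  | add a b => max (deg a) (deg b)
  | sub a b => max (deg a) (deg b)
  | mul a b => deg a + deg b

theorem totalDegree_toMv_le (δ : Fin 3 → ℝ) (e : Ex) : (toMv δ e).totalDegree ≤ deg e := by
  induction e with
  | var i => fin_cases i <;> simp [toMv, deg]
  | cst c => exact (MvPolynomial.totalDegree_C _).le
  | add a b iha ihb => exact (MvPolynomial.totalDegree_add _ _).trans (max_le_max iha ihb)
  | sub a b iha ihb => exact (MvPolynomial.totalDegree_sub _ _).trans (max_le_max iha ihb)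
  | mul a b iha ihb => exact (MvPolynomial.totalDegree_mul _ _).trans (add_le_add iha ihb)

theorem contDiff_ev (e : Ex) :
    ContDiff ℝ ω fun p : (Fin 3 → ℝ) × (Fin 4 → ℝ) => ev (env p.1 p.2) e := by
  induction e with
  | var i => fin_cases i <;> simp only [ev, env] <;> simp <;> fun_prop
  | cst c => exact contDiff_const
  | add a b iha ihb => exact iha.add ihb
  | sub a b iha ihb => exact iha.sub ihb
  | mul a b iha ihb => exact iha.mul ihb

theorem hasFDerivAt_ev (δ : Fin 3 → ℝ) (y : Fin 4 → ℝ) (e : Ex) :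
    HasFDerivAt (fun y => ev (env δ y) e)
      (∑ k, ev (env δ y) (diff k e) • ContinuousLinearMap.proj (R := ℝ) (φ := fun _ => ℝ) k) y := by
  induction e with
  | var i =>
    have hp (k : Fin 4) := hasFDerivAt_apply (𝕜 := ℝ) (F' := fun _ : Fin 4 => ℝ) k y
    have hc (c : ℝ) := hasFDerivAt_const (𝕜 := ℝ) c y
    fin_cases i
    · convert! hp 0 using 1; simp [Fin.sum_univ_four, diff]
    · convert! hp 1 using 1; simp [Fin.sum_univ_four, diff]
    · convert! hp 2 using 1; simp [Fin.sum_univ_four, diff]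
    · convert! hp 3 using 1; simp [Fin.sum_univ_four, diff]
    · convert! hc (δ 0 / 2) using 1; simp [Fin.sum_univ_four, diff]
    · convert! hc (δ 1) using 1; simp [Fin.sum_univ_four, diff]
    · convert! hc (δ 2) using 1; simp [Fin.sum_univ_four, diff]
  | cst c => simpa [diff] using hasFDerivAt_const (𝕜 := ℝ) (c : ℝ) y
  | add a b iha ihb =>
    convert! iha.add ihb using 1
    simp [diff, ev, add_smul, Finset.sum_add_distrib]
  | sub a b iha ihb =>
    convert! iha.sub ihb using 1
    rw [← Finset.sum_sub_distrib]
    refine Finset.sum_congr rfl fun k _ => ContinuousLinearMap.ext fun w => ?_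
    simp [diff, ev, sub_mul]
  | mul a b iha ihb =>
    convert! iha.mul ihb using 1
    simp only [diff, ev, add_smul, Finset.sum_add_distrib, Finset.smul_sum, smul_smul]
    rw [add_comm]
    congr 1
    exact Finset.sum_congr rfl fun k _ => by rw [mul_comm]

/-- The fixed-point scale of the interval arithmetic. -/
def scale : ℤ := 1000000000000000000000000

/-- Interval arithmetic with midpoints and radii, in units of `1 / scale`. -/
def encl (m e : Fin 7 → ℤ) : Ex → ℤ × ℤ
  | var i => (m i, e i)
  | cst c => (c * scale, 0)
  | add a b => ((encl m e a).1 + (encl m e b).1, (encl m e a).2 + (encl m e b).2)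
  | sub a b => ((encl m e a).1 - (encl m e b).1, (encl m e a).2 + (encl m e b).2)
  -- Both divisions round down and lose at most one unit each: one in the midpoint, one in the
  -- radius. The summand 2 absorbs both.
  | mul a b => ((encl m e a).1 * (encl m e b).1 / scale,
      ((encl m e a).1.natAbs * (encl m e b).2 + (encl m e b).1.natAbs * (encl m e a).2
        + (encl m e a).2 * (encl m e b).2) / scale + 2)

/-- The box with the given midpoints and radii. -/
def Box (m e : Fin 7 → ℤ) (z : Fin 7 → ℝ) : Prop := ∀ i, |scale * z i - m i| ≤ e i

theorem mul_bound {N A B a b d f : ℝ} (hA : |A - a| ≤ d) (hB : |B - b| ≤ f) (hN : 0 < N) :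
    |A * B / N - a * b / N| ≤ (|a| * f + |b| * d + d * f) / N := by
  rw [← sub_div, abs_div, abs_of_pos hN]
  gcongr
  calc |A * B - a * b| = |a * (B - b) + b * (A - a) + (A - a) * (B - b)| := by ring_nf
    _ ≤ |a| * |B - b| + |b| * |A - a| + |A - a| * |B - b| := by
      simpa only [abs_mul] using abs_add_three (a * (B - b)) (b * (A - a)) ((A - a) * (B - b))
    _ ≤ _ := by
      have := abs_nonneg (A - a)
      have := abs_nonneg (B - b)
      gcongr
      linarith

theorem div_scale_bound (k : ℤ) :
    ((k / scale : ℤ) : ℝ) ≤ k / (scale : ℝ) ∧ (k : ℝ) / scale ≤ ((k / scale : ℤ) : ℝ) + 1 := by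
  have hN : (0 : ℝ) < scale := by norm_num [scale]
  have hN' : 0 < scale := by decide
  constructor
  · rw [le_div_iff₀ hN]
    exact_mod_cast Int.ediv_mul_le k hN'.ne'
  · rw [div_le_iff₀ hN]
    exact_mod_cast (Int.lt_ediv_add_one_mul_self k hN').le

theorem encl_spec {m e : Fin 7 → ℤ} {z : Fin 7 → ℝ} (hz : Box m e z) (p : Ex) :
    |scale * ev z p - (encl m e p).1| ≤ (encl m e p).2 := by
  have hN : (0 : ℝ) < scale := by norm_num [scale]
  induction p with
  | var i => exact hz i
  | cst c => simp [encl, mul_comm]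
  | add a b iha ihb =>
    simp only [encl, ev]
    push_cast
    rw [abs_le] at *
    constructor <;> linarith
  | sub a b iha ihb =>
    simp only [encl, ev]
    push_cast
    rw [abs_le] at *
    constructor <;> linarith
  | mul a b iha ihb =>
    have h := mul_bound iha ihb hN
    simp only [encl, ev]
    have h1 := div_scale_bound ((encl m e a).1 * (encl m e b).1)
    have h2 := div_scale_bound ((encl m e a).1.natAbs * (encl m e b).2
        + (encl m e b).1.natAbs * (encl m e a).2 + (encl m e a).2 * (encl m e b).2)
    have h3 : scale * ev z a * (scale * ev z b) / scale = scale * (ev z a * ev z b) := by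
      field_simp
    rw [h3] at h
    push_cast [Nat.cast_natAbs] at h1 h2 ⊢
    rw [abs_le] at *
    constructor <;> linarith

theorem lt_ev_of_encl {m e : Fin 7 → ℤ} {z : Fin 7 → ℝ} (hz : Box m e z) (p : Ex) (c : ℤ)
    (h : c * scale < (encl m e p).1 - (encl m e p).2) : (c : ℝ) < ev z p := by
  have hN : (0 : ℝ) < scale := by norm_num [scale]
  have h1 := (abs_le.1 (encl_spec hz p)).1
  have h2 : (c : ℝ) * scale < (encl m e p).1 - (encl m e p).2 := by exact_mod_cast h
  nlinarith

theorem ev_pos_of_encl {m e : Fin 7 → ℤ} {z : Fin 7 → ℝ} (hz : Box m e z) (p : Ex)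
    (h : 0 < (encl m e p).1 - (encl m e p).2) : 0 < ev z p := by
  exact_mod_cast lt_ev_of_encl hz p 0 (by simpa using h)

theorem abs_ev_le_of_encl {m e : Fin 7 → ℤ} {z : Fin 7 → ℝ} (hz : Box m e z) (p : Ex) (c : ℤ)
    (h : (encl m e p).1.natAbs + (encl m e p).2 ≤ c) : scale * |ev z p| ≤ c := by
  have hN : (0 : ℝ) < scale := by norm_num [scale]
  have h1 := encl_spec hz p
  have h2 : |((encl m e p).1 : ℝ)| + (encl m e p).2 ≤ c := by
    rw [Int.natCast_natAbs] at h; exact_mod_cast h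
  have h3 : scale * |ev z p| = |scale * ev z p| := by rw [abs_mul, abs_of_pos hN]
  have := abs_sub_abs_le_abs_sub (scale * ev z p) (encl m e p).1
  linarith

end Ex

end ReducedPolytope

/-! ### The system and an exact root for δ₀ -/

namespace ReducedPolytope

open Ex

/-- The four polynomials of the system, as expressions. -/
def sys : Fin 4 → Ex :=
  let x := var 0; let s := var 1; let h := var 2; let r := var 3
  let t := var 4; let d₂ := var 5; let d₃ := var 6
  -- The cᵢ are the coordinates of n₂ and p = ⟪n₂, v₅ - v₂⟫; the aᵢ are those of n₄ and w = ⟪n₄, v₁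
  -- - v₄⟫. Moreover n₅ = (h + r - x)(s - t, s - t, k) with ⟪n₅, v₁ - v₄⟫ = 2(h + r - x)l, and n₁ =
  -- -2h(s + t, 0, -x), which explains the factors divided out.
  let c₁ := h * (s + t) - x * (t - s)
  let c₂ := (s + t) * (r - x) - (r - h) * (t - s)
  let c₃ := x * (r - x) - h * (r - h)
  let p := c₁ * (h + r) + c₂ * x + c₃ * (s + t)
  let l := r * (s - t) - t * (x + h - r)
  let k := x + h - r
  let a₁ := (t + s) * (x - r) - x * (t - s)
  let a₂ := 0 - (t + s) * h - (r - h) * (t - s)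
  let a₃ := (r - h) * (x - r) + x * h
  let w := a₁ * r + a₂ * r - 2 * t * a₃
  ![4 * ((r * (s + t) + 2 * t * x) * (r * (s + t) + 2 * t * x) - (s + t) * (s + t) - x * x),
    p * p - c₁ * c₁ - c₂ * c₂ - c₃ * c₃,
    4 * l * l - d₃ * d₃ * (2 * (s - t) * (s - t) + k * k),
    w * w - d₂ * d₂ * (a₁ * a₁ + a₂ * a₂ + a₃ * a₃)]

theorem deg_sys_le (i : Fin 4) : deg (sys i) ≤ 6 := by
  revert i
  decide

/-- The system of polynomials. -/
noncomputable def sysPoly (δ : Fin 3 → ℝ) (i : Fin 4) : MvPolynomial (Fin 4) ℝ := toMv δ (sys i)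

/-- An integral multiple of an approximate inverse of the Jacobian at `δ₀`. -/
def precond : Matrix (Fin 4) (Fin 4) ℤ :=
  !![-142, 3033, -2086, 26015; -320, -18620, 3066, 47756; 373, 18749, -686, -72395;
    106, -12450, 3047, 10703]

/-- The preconditioned system. -/
def precondSys (i : Fin 4) : Ex :=
  cst (precond i 0) * sys 0 + cst (precond i 1) * sys 1 + cst (precond i 2) * sys 2
    + cst (precond i 3) * sys 3

/-- The Jacobian matrix of the system. -/
noncomputable def jac (δ : Fin 3 → ℝ) (y : Fin 4 → ℝ) : Matrix (Fin 4) (Fin 4) ℝ :=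
  .of fun i k => ev (env δ y) (diff k (sys i))

/-- Midpoints of the box used to locate the root, in units of `1 / scale`. -/
def rootMid : Fin 7 → ℤ :=
  ![617649095979952755908963, 135138493102613763734321, 98430025240910907154245,
    354718358670911727231201, 550000000000000000000000, 1003000000000000000000000,
    1004000000000000000000000]

/-- Radii of the box used to locate the root. -/
def rootRad : Fin 7 → ℤ :=
  ![10000000000, 10000000000, 10000000000, 10000000000, 0, 0, 0]

/-- The approximate root. -/
noncomputable def rootApprox : Fin 4 → ℝ :=
  ![617649095979952755908963 / 10 ^ 24, 135138493102613763734321 / 10 ^ 24,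
    98430025240910907154245 / 10 ^ 24, 354718358670911727231201 / 10 ^ 24]

theorem box_rootApprox : Box rootMid (fun _ => 0) (env δ₀ rootApprox) := by
  intro i
  fin_cases i <;> simp [rootMid, rootApprox, env, δ₀, scale] <;> norm_num

theorem box_of_mem_closedBall {y : Fin 4 → ℝ}
    (hy : y ∈ Metric.closedBall rootApprox (1 / 10 ^ 14)) : Box rootMid rootRad (env δ₀ y) := by
  have h (k : Fin 4) : |y k - rootApprox k| ≤ 1 / 10 ^ 14 :=
    (dist_le_pi_dist y rootApprox k).trans hy
  have h0 := h 0
  have h1 := h 1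
  have h2 := h 2
  have h3 := h 3
  intro i
  rw [abs_le] at *
  fin_cases i <;> simp [rootMid, rootRad, rootApprox, env, δ₀, scale] at * <;>
    constructor <;> linarith

theorem jac_precond (δ : Fin 3 → ℝ) (y : Fin 4 → ℝ) (i k : Fin 4) :
    (precond.map (Int.cast : ℤ → ℝ) * jac δ y) i k = ev (env δ y) (diff k (precondSys i)) := by
  have h (c : ℤ) (e : Ex) : ev (env δ y) (diff k (cst c * e)) = c * ev (env δ y) (diff k e) := by
    change ((0 : ℤ) : ℝ) * _ + _ * _ = _
    simp
  have h' (a b : Ex) : diff k (a + b) = diff k a + diff k b := rfl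
  simp only [precondSys, h', ev_add, h, Matrix.mul_apply, Fin.sum_univ_four, jac, Matrix.map_apply,
    Matrix.of_apply]

theorem precondSys_eq (δ : Fin 3 → ℝ) (y : Fin 4 → ℝ) :
    (fun i => ev (env δ y) (precondSys i)) =
      (precond.map (Int.cast : ℤ → ℝ)).mulVec fun i => ev (env δ y) (sys i) := by
  ext i
  simp [precondSys, Matrix.mulVec, dotProduct, Fin.sum_univ_four]

/-- `precond` is about 1000 times the inverse Jacobian. An entrywise error of ten percent is good
enough both for the invertibility of the Jacobian and for the existence of the root. -/
theorem abs_diff_precondSys_sub_le {y : Fin 4 → ℝ}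
    (hy : y ∈ Metric.closedBall rootApprox (1 / 10 ^ 14)) (i k : Fin 4) :
    |ev (env δ₀ y) (diff k (precondSys i)) - if i = k then 1000 else 0| ≤ 100 := by
  have hd : ∀ i k : Fin 4,
      ((encl rootMid rootRad (diff k (precondSys i) - cst (if i = k then 1000 else 0))).1.natAbs +
      (encl rootMid rootRad (diff k (precondSys i) - cst (if i = k then 1000 else 0))).2 : ℤ)
        ≤ 100 * scale := by
    decide +kernel
  have h := abs_ev_le_of_encl (box_of_mem_closedBall hy) _ _ (hd i k)
  have hN : (0 : ℝ) < scale := by norm_num [scale]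
  push_cast at h
  rw [mul_comm, mul_le_mul_iff_left₀ hN] at h
  simpa using h

/-- The preconditioned Jacobian is strictly diagonally dominant: its diagonal is at least 900, the
remaining entries of a row add up to at most 300. -/
theorem det_jac_ne_zero {y : Fin 4 → ℝ} (hy : y ∈ Metric.closedBall rootApprox (1 / 10 ^ 14)) :
    (jac δ₀ y).det ≠ 0 := by
  have h : (precond.map (Int.cast : ℤ → ℝ) * jac δ₀ y).det ≠ 0 := by
    apply det_ne_zero_of_sum_row_lt_diag
    intro i
    simp only [jac_precond, Real.norm_eq_abs]
    have h1 := abs_diff_precondSys_sub_le hy i i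
    calc _ ≤ ∑ j ∈ Finset.univ.erase i, (100 : ℝ) := Finset.sum_le_sum fun j hj => by
            simpa [(Finset.ne_of_mem_erase hj).symm] using abs_diff_precondSys_sub_le hy i j
      _ = 300 := by simp; norm_num
      _ < _ := by
        simp only [if_true, abs_le] at h1
        refine lt_of_lt_of_le ?_ (le_abs_self _)
        linarith
  rw [Matrix.det_mul] at h
  exact right_ne_zero_of_mul h

/-- By the mean value inequality f differs from the identity by a map with Lipschitz constant 1/2.
Hence the image of the ball of radius ε about b contains the ball of radius ε/2 about f b, and that
ball contains 0. -/
theorem exists_zero_of_norm_fderiv_sub_id_le {E : Type*} [NormedAddCommGroup E] [NormedSpace ℝ E]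
    [CompleteSpace E] [Nontrivial E] {f : E → E} {f' : E → E →L[ℝ] E} {b : E} {ε : ℝ} (hε : 0 ≤ ε)
    (hf : ∀ y ∈ Metric.closedBall b ε, HasFDerivAt f (f' y) y)
    (hf' : ∀ y ∈ Metric.closedBall b ε, ‖f' y - .id ℝ E‖ ≤ 1 / 2) (hb : ‖f b‖ ≤ ε / 2) :
    ∃ y ∈ Metric.closedBall b ε, f y = 0 := by
  have h : ApproximatesLinearOn f ((ContinuousLinearEquiv.refl ℝ E : E ≃L[ℝ] E) : E →L[ℝ] E)
      (Metric.closedBall b ε) (1 / 2) := by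
    rw [ApproximatesLinearOn.approximatesLinearOn_iff_lipschitzOnWith]
    refine (convex_closedBall b ε).lipschitzOnWith_of_nnnorm_hasFDerivWithin_le
      (f' := fun y => f' y - .id ℝ E) (fun y hy => ?_) fun y hy => ?_
    · exact (hf y hy).hasFDerivWithinAt.sub (ContinuousLinearMap.id ℝ E).hasFDerivWithinAt
    · rw [← NNReal.coe_le_coe]
      simpa using hf' y hy
  have h1 := h.surjOn_closedBall_of_nonlinearRightInverse
    (ContinuousLinearEquiv.refl ℝ E).toNonlinearRightInverse hε subset_rfl
  have hn : ((ContinuousLinearEquiv.refl ℝ E).toNonlinearRightInverse.nnnorm : ℝ) = 1 :=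
    ContinuousLinearMap.norm_id
  refine h1 ?_
  rw [hn, mem_closedBall_iff_norm', sub_zero]
  refine hb.trans ?_
  norm_num
  linarith

theorem exists_root : ∃ y ∈ Metric.closedBall rootApprox (1 / 10 ^ 14),
    ∀ i, ev (env δ₀ y) (sys i) = 0 := by
  let f (y : Fin 4 → ℝ) (i : Fin 4) : ℝ := 1 / 1000 * ev (env δ₀ y) (precondSys i)
  let f' (y : Fin 4 → ℝ) : (Fin 4 → ℝ) →L[ℝ] (Fin 4 → ℝ) := ContinuousLinearMap.pi fun i =>
    (1 / 1000 : ℝ) • ∑ k, ev (env δ₀ y) (diff k (precondSys i)) •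
      ContinuousLinearMap.proj (R := ℝ) (φ := fun _ => ℝ) k
  obtain ⟨y, hy, hfy⟩ : ∃ y ∈ Metric.closedBall rootApprox (1 / 10 ^ 14), f y = 0 := by
    refine exists_zero_of_norm_fderiv_sub_id_le (f := f) (f' := f') (by norm_num) (fun y hy => ?_)
      (fun y hy => ?_) ?_
    · exact hasFDerivAt_pi.2 fun i => (hasFDerivAt_ev δ₀ y (precondSys i)).const_mul _
    · refine ContinuousLinearMap.opNorm_le_bound _ (by norm_num) fun w => ?_
      rw [pi_norm_le_iff_of_nonneg (by positivity)]
      intro i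
      have hw : (f' y - .id ℝ (Fin 4 → ℝ)) w i = ∑ k, 1 / 1000 *
          ((ev (env δ₀ y) (diff k (precondSys i)) - if i = k then 1000 else 0) * w k) := by
        simp only [f', sub_mul, mul_sub, Finset.sum_sub_distrib]
        simp [Finset.mul_sum]
      rw [hw, Real.norm_eq_abs]
      refine (Finset.abs_sum_le_sum_abs _ _).trans ?_
      -- In the sup norm, a row of four entries of size at most 0.1 gives 0.4 ≤ 1/2.
      calc _ ≤ ∑ k : Fin 4, 1 / 1000 * (100 * ‖w‖) := Finset.sum_le_sum fun k _ => by
              rw [abs_mul, abs_mul, abs_of_pos (by norm_num)]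
              have := abs_diff_precondSys_sub_le hy i k
              have := norm_le_pi_norm w k
              rw [Real.norm_eq_abs] at this
              gcongr
        _ ≤ _ := by
          have := norm_nonneg w
          simp
          linarith
    · rw [pi_norm_le_iff_of_nonneg (by norm_num)]
      intro i
      -- The bound 10¹² means 10⁻¹² in real units. After division by 1000 this is 10⁻¹⁵, below half
      -- the radius 10⁻¹⁴ of the ball.
      have hd : ∀ i : Fin 4, ((encl rootMid (fun _ => 0) (precondSys i)).1.natAbs +
          (encl rootMid (fun _ => 0) (precondSys i)).2 : ℤ) ≤ 1000000000000 := by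
        decide +kernel
      have h := abs_ev_le_of_encl box_rootApprox _ _ (hd i)
      have hN : (scale : ℝ) = 10 ^ 24 := by norm_num [scale]
      rw [hN] at h
      simp only [f, Real.norm_eq_abs, abs_mul]
      rw [abs_of_pos (by norm_num)]
      norm_num at h ⊢
      linarith
  refine ⟨y, hy, fun i => ?_⟩
  have hq : (precond.map (Int.cast : ℤ → ℝ)).mulVec (fun i => ev (env δ₀ y) (sys i)) = 0 := by
    rw [← precondSys_eq]
    ext i
    have := congrFun hfy i
    simpa [f] using this
  -- As `precond` is invertible, a zero of the preconditioned system is a zero of the original one.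
  have hdet : (precond.map (Int.cast : ℤ → ℝ)).det ≠ 0 := by
    have h : precond.det ≠ 0 := by decide +kernel
    have := Int.cast_det (R := ℝ) precond
    rw [← this]
    exact_mod_cast h
  exact congrFun (Matrix.eq_zero_of_mulVec_eq_zero hdet hq) i

end ReducedPolytope

/-! ### The smooth family of roots -/

namespace ReducedPolytope

open Ex Topology

/-- Radii of a box around the root on which the shape of the polytope is controlled. -/
def boxRad : Fin 7 → ℤ := fun _ => 1000000000000000

theorem hasFDerivAt_sys (δ : Fin 3 → ℝ) (y : Fin 4 → ℝ) :
    HasFDerivAt (fun y i => ev (env δ y) (sys i)) (Matrix.toLin' (jac δ y)).toContinuousLinearMap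
      y := by
  refine (hasFDerivAt_pi.2 fun i => hasFDerivAt_ev δ y (sys i)).congr_fderiv ?_
  ext w i
  simp [jac, Matrix.mulVec, dotProduct]

theorem isInvertible_of_det_ne_zero {M : Matrix (Fin 4) (Fin 4) ℝ} (h : M.det ≠ 0) :
    (Matrix.toLin' M).toContinuousLinearMap.IsInvertible := by
  refine ⟨(LinearEquiv.ofInjectiveEndo (Matrix.toLin' M) ?_).toContinuousLinearEquiv, ?_⟩
  · rw [← LinearMap.ker_eq_bot, LinearMap.ker_eq_bot']
    intro w hw
    exact Matrix.eq_zero_of_mulVec_eq_zero h (by simpa using hw)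
  · ext w
    simp

theorem exists_smooth_root : ∃ (U : Set (Fin 3 → ℝ)) (φ : (Fin 3 → ℝ) → (Fin 4 → ℝ)),
    IsOpen U ∧ δ₀ ∈ U ∧ ContDiffOn ℝ ∞ φ U ∧ φ δ₀ ∈ Metric.closedBall rootApprox (1 / 10 ^ 14) ∧
    ∀ δ ∈ U, (∀ i, ev (env δ (φ δ)) (sys i) = 0) ∧ Box rootMid boxRad (env δ (φ δ)) := by
  obtain ⟨y, hy, hr⟩ := exists_root
  let F (p : (Fin 3 → ℝ) × (Fin 4 → ℝ)) (i : Fin 4) : ℝ := ev (env p.1 p.2) (sys i)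
  have hF : ContDiff ℝ ω F := contDiff_pi.2 fun i => contDiff_ev (sys i)
  have hFu : F (δ₀, y) = 0 := funext hr
  have hFa : ContDiffAt ℝ ω F (δ₀, y) := hF.contDiffAt
  have hinv : (fderiv ℝ F (δ₀, y) ∘L .inr ℝ (Fin 3 → ℝ) (Fin 4 → ℝ)).IsInvertible := by
    have h1 : HasFDerivAt F (fderiv ℝ F (δ₀, y)) (δ₀, y) :=
      (hF.differentiable (by simp)).differentiableAt.hasFDerivAt
    have h2 := h1.comp y (hasFDerivAt_prodMk_right δ₀ y)
    rw [h2.unique (hasFDerivAt_sys δ₀ y)]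
    exact isInvertible_of_det_ne_zero (det_jac_ne_zero hy)
  let φ := hFa.implicitFunction (by simp) hinv
  have hφ₀ : φ δ₀ = y := hFa.implicitFunction_apply_self (by simp) hinv
  have hφ : ContDiffAt ℝ ω φ δ₀ := hFa.contDiffAt_implicitFunction (by simp) hinv
  have hφF : ∀ᶠ δ in 𝓝 δ₀, F (δ, φ δ) = F (δ₀, y) :=
    hFa.eventually_apply_implicitFunction (by simp) hinv
  have hφs : ∀ᶠ δ in 𝓝 δ₀, ContDiffAt ℝ ω φ δ := hφ.eventually (by simp)
  -- The root at δ₀ lies in the box `rootRad`, strictly inside the larger box `boxRad`; by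
  -- continuity nearby roots stay in the latter.
  have hbox : ∀ᶠ δ in 𝓝 δ₀, Box rootMid boxRad (env δ (φ δ)) := by
    refine Filter.eventually_all.2 fun i => ?_
    have hc : ContinuousAt (fun δ => |scale * env δ (φ δ) i - rootMid i|) δ₀ := by
      have h1 : ContinuousAt (fun δ => env δ (φ δ) i) δ₀ :=
        ((contDiff_ev (var i)).continuous.continuousAt (x := (δ₀, φ δ₀))).comp_of_eq
          (f := fun δ => (δ, φ δ)) (continuousAt_id.prodMk hφ.continuousAt) rfl
      exact ((continuousAt_const.mul h1).sub continuousAt_const).abs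
    have h0 : |scale * env δ₀ (φ δ₀) i - rootMid i| < boxRad i := by
      rw [hφ₀]
      refine (box_of_mem_closedBall hy i).trans_lt ?_
      fin_cases i <;> simp [rootRad, boxRad] <;> norm_num
    exact (hc.eventually_lt_const h0).mono fun _ h => h.le
  obtain ⟨U, hU, hUo, hU₀⟩ := eventually_nhds_iff.1 (hφF.and (hφs.and hbox))
  refine ⟨U, φ, hUo, hU₀, fun δ hδ => ((hU δ hδ).2.1.of_le le_top).contDiffWithinAt, ?_,
    fun δ hδ => ⟨fun i => ?_, (hU δ hδ).2.2⟩⟩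
  · rwa [hφ₀]
  · have := (hU δ hδ).1
    rw [hFu] at this
    exact congrFun this i

end ReducedPolytope

/-! ### Support functions, width, reducedness and distances of affine hulls -/

namespace ReducedPolytope

open Module

section Support

variable {d : ℕ} {K S : Set (E d)} {u v q : E d}

theorem bddAbove_inner (hK : IsCompact K) (u : E d) :
    BddAbove {a : ℝ | ∃ x ∈ K, a = inner ℝ u x} := by
  have h := (hK.image (f := fun x => inner ℝ u x) (by fun_prop)).bddAbove
  refine h.mono ?_
  rintro a ⟨x, hx, rfl⟩
  exact ⟨x, hx, rfl⟩

theorem inner_le_supportFn (hK : IsCompact K) (u : E d) {x : E d} (hx : x ∈ K) :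
    inner ℝ u x ≤ supportFn K u :=
  le_csSup (bddAbove_inner hK u) ⟨x, hx, rfl⟩

theorem supportFn_le (hne : K.Nonempty) {c : ℝ} (h : ∀ x ∈ K, inner ℝ u x ≤ c) :
    supportFn K u ≤ c := by
  obtain ⟨x, hx⟩ := hne
  refine csSup_le ⟨_, x, hx, rfl⟩ ?_
  rintro a ⟨y, hy, rfl⟩
  exact h y hy

theorem exists_inner_eq_supportFn (hK : IsCompact K) (hne : K.Nonempty) (u : E d) :
    ∃ x ∈ K, inner ℝ u x = supportFn K u := by
  obtain ⟨x, hx, hmax⟩ := hK.exists_isMaxOn (f := fun x => inner ℝ u x) hne (by fun_prop)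
  exact ⟨x, hx, (inner_le_supportFn hK u hx).antisymm (supportFn_le hne hmax)⟩

theorem inner_le_of_mem_convexHull {c : ℝ} (h : ∀ x ∈ S, inner ℝ u x ≤ c) {x : E d}
    (hx : x ∈ convexHull ℝ S) : inner ℝ u x ≤ c :=
  convexHull_min h (convex_halfSpace_le (innerSL ℝ u).toLinearMap.isLinear c) hx

theorem supportFn_convexHull (hv : v ∈ S) (h : ∀ x ∈ S, inner ℝ u x ≤ inner ℝ u v) :
    supportFn (convexHull ℝ S) u = inner ℝ u v := by
  refine IsGreatest.csSup_eq ⟨⟨v, subset_convexHull ℝ S hv, rfl⟩, ?_⟩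
  rintro a ⟨x, hx, rfl⟩
  exact inner_le_of_mem_convexHull h hx

/-- An open half-space together with one point of its boundary is convex. -/
theorem eq_or_inner_lt_of_mem_convexHull (h : ∀ x ∈ S, x ≠ v → inner ℝ u x < inner ℝ u v)
    {x : E d} (hx : x ∈ convexHull ℝ S) : x = v ∨ inner ℝ u x < inner ℝ u v := by
  have hc : Convex ℝ {x : E d | x = v ∨ inner ℝ u x < inner ℝ u v} := by
    rw [convex_iff_forall_pos]
    rintro x hx y hy a b ha hb hab
    have hi : inner ℝ u (a • x + b • y) = a * inner ℝ u x + b * inner ℝ u y := by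
      rw [inner_add_right, inner_smul_right, inner_smul_right]
    have ha' : a = 1 - b := by linarith
    rcases hx with rfl | hx <;> rcases hy with rfl | hy
    · left
      rw [← add_smul, hab, one_smul]
    all_goals right; rw [hi]; subst ha'
    · nlinarith
    · nlinarith
    · nlinarith
  exact convexHull_min (fun x hx => (em (x = v)).imp id (h x hx)) hc hx

theorem inner_le_of_forall_lt (h : ∀ x ∈ S, x ≠ v → inner ℝ u x < inner ℝ u v) :
    ∀ x ∈ S, inner ℝ u x ≤ inner ℝ u v := fun x hx => by
  rcases eq_or_ne x v with rfl | hxv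
  · exact le_rfl
  · exact (h x hx hxv).le

theorem face_eq_singleton (hv : v ∈ S) (h : ∀ x ∈ S, x ≠ v → inner ℝ u x < inner ℝ u v) :
    supportHyperplane (convexHull ℝ S) u ∩ convexHull ℝ S = {v} := by
  have hs := supportFn_convexHull hv (inner_le_of_forall_lt h)
  ext x
  simp only [supportHyperplane, hs, Set.mem_inter_iff, Set.mem_ofPred_eq, Set.mem_singleton_iff]
  constructor
  · rintro ⟨h1, h2⟩
    exact (eq_or_inner_lt_of_mem_convexHull h h2).resolve_right h1.not_lt
  · rintro rfl
    exact ⟨rfl, subset_convexHull ℝ S hv⟩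

theorem mem_extremePoints_of_inner_lt (hv : v ∈ S)
    (h : ∀ x ∈ S, x ≠ v → inner ℝ u x < inner ℝ u v) :
    v ∈ (convexHull ℝ S).extremePoints ℝ := by
  refine ⟨subset_convexHull ℝ S hv, fun x hx y hy hxy => ?_⟩
  obtain ⟨a, b, ha, hb, hab, hv'⟩ := hxy
  have hx' := eq_or_inner_lt_of_mem_convexHull h hx
  have hy' := inner_le_of_mem_convexHull (inner_le_of_forall_lt h) hy
  refine hx'.resolve_right fun hlt => ?_
  have hi : inner ℝ u v = a * inner ℝ u x + b * inner ℝ u y := by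
    rw [← hv', inner_add_right, inner_smul_right, inner_smul_right]
  have ha' : a = 1 - b := by linarith
  subst ha'
  nlinarith

/-- A vertex of the convex hull of a finite set belongs to this set. -/
theorem mem_of_isVertex (hS : S.Finite) (hne : S.Nonempty) (h : IsVertex (convexHull ℝ S) v) :
    v ∈ S := by
  obtain ⟨u, -, hu⟩ := h
  obtain ⟨w, hw, hmax⟩ := hS.exists_maximalFor (fun x => inner ℝ u x) S hne
  have hs := supportFn_convexHull (u := u) hw fun x hx => by
    by_contra! hlt
    exact hlt.not_ge (hmax hx hlt.le)
  have hmem : w ∈ supportHyperplane (convexHull ℝ S) u ∩ convexHull ℝ S :=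
    ⟨hs.symm, subset_convexHull ℝ S hw⟩
  rw [← hu] at hmem
  rwa [← Set.mem_singleton_iff.1 hmem]

theorem inner_sub_le_width (hK : IsCompact K) (u : E d) {x y : E d} (hx : x ∈ K) (hy : y ∈ K) :
    inner ℝ u (x - y) ≤ width K u := by
  have h1 := inner_le_supportFn hK u hx
  have h2 := inner_le_supportFn hK (-u) hy
  rw [inner_neg_left] at h2
  rw [inner_sub_right, width]
  linarith

theorem width_neg (K : Set (E d)) (u : E d) : width K (-u) = width K u := by
  simp only [width, neg_neg, add_comm]

theorem minWidth_le_width (hK : IsCompact K) (hne : K.Nonempty) (hu : ‖u‖ = 1) :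
    minWidth K ≤ width K u := by
  refine csInf_le ⟨0, ?_⟩ ⟨u, hu, rfl⟩
  rintro w ⟨u, -, rfl⟩
  obtain ⟨x, hx⟩ := hne
  simpa using inner_sub_le_width hK u hx hx

/-- If every vertex is the only point at which a linear functional realizing the minimum width is
maximal, then the polytope is reduced. -/
theorem isReduced_of_forall_exists (hP : IsConvexBody (convexHull ℝ S))
    (h : ∀ v ∈ S, ∃ u : E d, ‖u‖ = 1 ∧ (∀ x ∈ S, x ≠ v → inner ℝ u x < inner ℝ u v) ∧
      width (convexHull ℝ S) u = minWidth (convexHull ℝ S)) :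
    IsReduced (convexHull ℝ S) := by
  refine ⟨hP, fun K hK hKP => ?_⟩
  -- If K contained S, it would contain the whole hull.
  obtain ⟨v, hvS, hvK⟩ : ∃ v ∈ S, v ∉ K := by
    by_contra! hSK
    exact hKP.2 (convexHull_min hSK hK.convex)
  obtain ⟨u, hu, hlt, hw⟩ := h v hvS
  have hne : K.Nonempty := hK.nonempty_interior.mono interior_subset
  refine (minWidth_le_width hK.isCompact hne hu).trans_lt ?_
  rw [← hw, width, width]
  refine add_lt_add_of_le_of_lt (supportFn_le hne fun x hx =>
    inner_le_supportFn hP.isCompact _ (hKP.1 hx)) ?_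
  -- By compactness the maximum of u over K is attained. The point where this happens is not v, so
  -- the value lies strictly below ⟪u, v⟫.
  obtain ⟨x, hx, hxu⟩ := exists_inner_eq_supportFn hK.isCompact hne u
  rw [← hxu, supportFn_convexHull hvS (inner_le_of_forall_lt hlt)]
  refine (eq_or_inner_lt_of_mem_convexHull hlt (hKP.1 hx)).resolve_left ?_
  rintro rfl
  exact hvK hx

theorem supportFn_image {g : E d ≃ₗᵢ[ℝ] E d} (hg : g '' K = K) (u : E d) :
    supportFn K (g u) = supportFn K u := by
  unfold supportFn
  congr 1
  ext a
  constructor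
  · rintro ⟨x, hx, rfl⟩
    rw [← hg] at hx
    obtain ⟨y, hy, rfl⟩ := hx
    exact ⟨y, hy, g.inner_map_map u y⟩
  · rintro ⟨x, hx, rfl⟩
    exact ⟨g x, hg ▸ Set.mem_image_of_mem g hx, (g.inner_map_map u x).symm⟩

theorem width_image {g : E d ≃ₗᵢ[ℝ] E d} (hg : g '' K = K) (u : E d) :
    width K (g u) = width K u := by
  rw [width, width, ← map_neg, supportFn_image hg, supportFn_image hg]

theorem inner_eq_zero_of_mem_vectorSpan {A : Set (E d)} {n p : E d}
    (hA : ∀ a ∈ A, inner ℝ n a = inner ℝ n p) : vectorSpan ℝ A ≤ (ℝ ∙ n)ᗮ := by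
  rw [vectorSpan, Submodule.span_le]
  rintro _ ⟨a, ha, b, hb, rfl⟩
  rw [SetLike.mem_coe, Submodule.mem_orthogonal_singleton_iff_inner_right]
  change inner ℝ n (a - b) = 0
  rw [inner_sub_right, hA a ha, hA b hb, sub_self]

/-- The distance of two affine subspaces whose directions span a hyperplane. -/
theorem rho_eq {A B : Set (E d)} {p q n : E d} (hp : p ∈ A) (hq : q ∈ B) (hn : n ≠ 0)
    (h : vectorSpan ℝ A ⊔ vectorSpan ℝ B = (ℝ ∙ n)ᗮ) :
    rho A B = |inner ℝ n (p - q)| / ‖n‖ := by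
  have hn' : 0 < ‖n‖ := norm_pos_iff.2 hn
  have hpA := mem_affineSpan ℝ hp
  have hqB := mem_affineSpan ℝ hq
  refine IsLeast.csInf_eq ⟨?_, ?_⟩
  -- The vector c • n is the projection of p - q to the line of n. The remainder splits along the
  -- two directions, and moving p and q by its parts gives the feet of a common perpendicular.
  · let c := inner ℝ n (p - q) / ‖n‖ ^ 2
    have hw : p - q - c • n ∈ (ℝ ∙ n)ᗮ := by
      rw [Submodule.mem_orthogonal_singleton_iff_inner_right, inner_sub_right, inner_smul_right,
        real_inner_self_eq_norm_sq, div_mul_cancel₀ _ (by positivity), sub_self]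
    rw [← h, Submodule.mem_sup] at hw
    obtain ⟨a, ha, b, hb, hab⟩ := hw
    refine ⟨-a +ᵥ p, AffineSubspace.vadd_mem_of_mem_direction ?_ hpA, b +ᵥ q,
      AffineSubspace.vadd_mem_of_mem_direction ?_ hqB, ?_⟩
    · rw [direction_affineSpan]
      exact neg_mem ha
    · rwa [direction_affineSpan]
    · have : (-a +ᵥ p) - (b +ᵥ q) = c • n := by
        have h1 : (-a +ᵥ p) - (b +ᵥ q) = p - q - (a + b) := by simp only [vadd_eq_add]; abel
        rw [h1, hab, sub_sub_cancel]
      rw [this, norm_smul, Real.norm_eq_abs, abs_div, abs_of_pos (by positivity : 0 < ‖n‖ ^ 2)]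
      field_simp
  · rintro _ ⟨x, hx, y, hy, rfl⟩
    -- The functional ⟪n, ·⟫ is constant on either affine hull, so Cauchy–Schwarz bounds every
    -- distance from below.
    rw [div_le_iff₀ hn', mul_comm]
    have h1 : inner ℝ n (x - p) = 0 := by
      rw [← Submodule.mem_orthogonal_singleton_iff_inner_right, ← h]
      refine Submodule.mem_sup_left ?_
      rw [← direction_affineSpan]
      exact AffineSubspace.vsub_mem_direction hx hpA
    have h2 : inner ℝ n (y - q) = 0 := by
      rw [← Submodule.mem_orthogonal_singleton_iff_inner_right, ← h]
      refine Submodule.mem_sup_right ?_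
      rw [← direction_affineSpan]
      exact AffineSubspace.vsub_mem_direction hy hqB
    have h3 : inner ℝ n (p - q) = inner ℝ n (x - y) := by
      simp only [inner_sub_right] at h1 h2 ⊢
      linarith
    rw [h3]
    exact abs_real_inner_le_norm n (x - y)

end Support

instance : Fact (finrank ℝ (E 3) = 2 + 1) := ⟨finrank_euclideanSpace_fin⟩

theorem eq_orthogonal_of_linearIndependent {V : Submodule ℝ (E 3)} {n a b : E 3} (hn : n ≠ 0)
    (hV : V ≤ (ℝ ∙ n)ᗮ) (ha : a ∈ V) (hb : b ∈ V) (hab : LinearIndependent ℝ ![a, b]) :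
    V = (ℝ ∙ n)ᗮ := by
  refine Submodule.eq_of_le_of_finrank_le hV ?_
  rw [Submodule.finrank_orthogonal_span_singleton (n := 2) hn]
  have h := finrank_span_eq_card hab
  rw [Fintype.card_fin] at h
  refine h.symm.le.trans (Submodule.finrank_mono (Submodule.span_le.2 ?_))
  rintro _ ⟨i, rfl⟩
  fin_cases i
  · exact ha
  · exact hb

theorem linearIndependent_of_cross_ne_zero {a b : E 3} (h : cross a b ≠ 0) :
    LinearIndependent ℝ ![a, b] := by
  rw [LinearIndependent.pair_iff]
  intro α β hαβ
  have h0 : α * a 0 + β * b 0 = 0 := by simpa using congrArg (fun p : E 3 => p 0) hαβ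
  have h1 : α * a 1 + β * b 1 = 0 := by simpa using congrArg (fun p : E 3 => p 1) hαβ
  have h2 : α * a 2 + β * b 2 = 0 := by simpa using congrArg (fun p : E 3 => p 2) hαβ
  constructor
  · by_contra hα
    refine h ?_
    ext i
    refine (mul_eq_zero.1 (?_ : α * _ = 0)).resolve_left hα
    fin_cases i <;> simp [cross, cross_apply, -mul_eq_zero]
    · linear_combination b 2 * h1 - b 1 * h2
    · linear_combination b 0 * h2 - b 2 * h0
    · linear_combination b 1 * h0 - b 0 * h1
  · by_contra hβ
    refine h ?_
    ext i
    refine (mul_eq_zero.1 (?_ : β * _ = 0)).resolve_left hβ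
    fin_cases i <;> simp [cross, cross_apply, -mul_eq_zero]
    · linear_combination a 1 * h2 - a 2 * h1
    · linear_combination a 2 * h0 - a 0 * h2
    · linear_combination a 0 * h1 - a 1 * h0

theorem cross_inner_left (a b : E 3) : inner ℝ (cross a b) a = 0 := by
  simp [cross, cross_apply, PiLp.inner_apply, Fin.sum_univ_three]
  ring

theorem cross_inner_right (a b : E 3) : inner ℝ (cross a b) b = 0 := by
  simp [cross, cross_apply, PiLp.inner_apply, Fin.sum_univ_three]
  ring

end ReducedPolytope

/-! ### Strictly antipodal vertex–facet pairs -/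

namespace ReducedPolytope

open Module

/-- The unit vector `u` certifies that `v` is a vertex of the convex hull of `S`, strictly antipodal
to a facet with vertices `q, a, b` at distance one. -/
structure Antipodal (S : Set (E 3)) (v u q a b : E 3) : Prop where
  mem : v ∈ S
  mem_q : q ∈ S
  mem_a : a ∈ S
  mem_b : b ∈ S
  lt : ∀ x ∈ S, x ≠ v → inner ℝ u x < inner ℝ u v
  le : ∀ x ∈ S, inner ℝ u q ≤ inner ℝ u x
  eq_a : inner ℝ u a = inner ℝ u q
  eq_b : inner ℝ u b = inner ℝ u q
  linearIndependent : LinearIndependent ℝ ![a - q, b - q]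
  gap : inner ℝ u (v - q) = 1
  norm_eq : ‖u‖ = 1

namespace Antipodal

variable {S : Set (E 3)} {v u q a b : E 3}

theorem of_cross {n : E 3} (mem : v ∈ S) (mem_q : q ∈ S) (mem_a : a ∈ S) (mem_b : b ∈ S)
    (lt : ∀ x ∈ S, x ≠ v → inner ℝ n x < inner ℝ n v) (le : ∀ x ∈ S, inner ℝ n q ≤ inner ℝ n x)
    (eq_a : inner ℝ n a = inner ℝ n q) (eq_b : inner ℝ n b = inner ℝ n q)
    (hc : cross (a - q) (b - q) ≠ 0) (hn : 0 < ‖n‖) (gap : inner ℝ n (v - q) = ‖n‖) :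
    Antipodal S v (‖n‖⁻¹ • n) q a b where
  mem := mem
  mem_q := mem_q
  mem_a := mem_a
  mem_b := mem_b
  lt x hx hxv := by
    rw [real_inner_smul_left, real_inner_smul_left]
    exact mul_lt_mul_of_pos_left (lt x hx hxv) (inv_pos.2 hn)
  le x hx := by
    rw [real_inner_smul_left, real_inner_smul_left]
    exact mul_le_mul_of_nonneg_left (le x hx) (inv_pos.2 hn).le
  eq_a := by rw [real_inner_smul_left, real_inner_smul_left, eq_a]
  eq_b := by rw [real_inner_smul_left, real_inner_smul_left, eq_b]
  linearIndependent := linearIndependent_of_cross_ne_zero hc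
  gap := by rw [real_inner_smul_left, gap, inv_mul_cancel₀ hn.ne']
  norm_eq := by rw [norm_smul, norm_inv, norm_norm, inv_mul_cancel₀ hn.ne']

theorem map (h : Antipodal S v u q a b) (g : E 3 ≃ₗᵢ[ℝ] E 3) (hg : g '' S = S) :
    Antipodal S (g v) (g u) (g q) (g a) (g b) := by
  have hm {x : E 3} (hx : x ∈ S) : g x ∈ S := hg ▸ Set.mem_image_of_mem g hx
  have hp {p : E 3 → Prop} (H : ∀ x ∈ S, p (g x)) : ∀ x ∈ S, p x := fun x hx => by
    rw [← hg] at hx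
    obtain ⟨y, hy, rfl⟩ := hx
    exact H y hy
  constructor
  · exact hm h.mem
  · exact hm h.mem_q
  · exact hm h.mem_a
  · exact hm h.mem_b
  · refine hp fun x hx hxv => ?_
    rw [g.inner_map_map, g.inner_map_map]
    exact h.lt x hx fun e => hxv (e ▸ rfl)
  · refine hp fun x hx => ?_
    rw [g.inner_map_map, g.inner_map_map]
    exact h.le x hx
  · rw [g.inner_map_map, g.inner_map_map, h.eq_a]
  · rw [g.inner_map_map, g.inner_map_map, h.eq_b]
  · have := h.linearIndependent.map' g.toLinearEquiv.toLinearMap g.toLinearEquiv.ker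
    convert! this using 1
    ext i
    fin_cases i <;> simp
  · rw [← map_sub, g.inner_map_map, h.gap]
  · rw [g.norm_map, h.norm_eq]

theorem ne_zero (h : Antipodal S v u q a b) : u ≠ 0 := by
  rw [← norm_ne_zero_iff, h.norm_eq]
  exact one_ne_zero

theorem supportFn_eq (h : Antipodal S v u q a b) :
    supportFn (convexHull ℝ S) u = inner ℝ u v :=
  supportFn_convexHull h.mem (inner_le_of_forall_lt h.lt)

theorem supportFn_neg_eq (h : Antipodal S v u q a b) :
    supportFn (convexHull ℝ S) (-u) = inner ℝ (-u) q :=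
  supportFn_convexHull h.mem_q fun x hx => by
    simpa only [inner_neg_left, neg_le_neg_iff] using h.le x hx

theorem width_eq (h : Antipodal S v u q a b) : width (convexHull ℝ S) u = 1 := by
  rw [width, h.supportFn_eq, h.supportFn_neg_eq, ← h.gap, inner_neg_left, inner_sub_right]
  ring

theorem mem_face {x : E 3} (h : Antipodal S v u q a b) :
    x ∈ supportHyperplane (convexHull ℝ S) (-u) ∩ convexHull ℝ S ↔
      inner ℝ u x = inner ℝ u q ∧ x ∈ convexHull ℝ S := by
  simp only [supportHyperplane, h.supportFn_neg_eq, Set.mem_inter_iff, Set.mem_ofPred_eq,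
    inner_neg_left, neg_inj]

theorem vectorSpan_face (h : Antipodal S v u q a b) :
    vectorSpan ℝ (supportHyperplane (convexHull ℝ S) (-u) ∩ convexHull ℝ S) = (ℝ ∙ u)ᗮ := by
  have hS := subset_convexHull ℝ S
  have hq := h.mem_face.2 ⟨rfl, hS h.mem_q⟩
  refine eq_orthogonal_of_linearIndependent h.ne_zero
    (inner_eq_zero_of_mem_vectorSpan fun x hx => (h.mem_face.1 hx).1)
    (vsub_mem_vectorSpan ℝ (h.mem_face.2 ⟨h.eq_a, hS h.mem_a⟩) hq)
    (vsub_mem_vectorSpan ℝ (h.mem_face.2 ⟨h.eq_b, hS h.mem_b⟩) hq) h.linearIndependent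

theorem exists_facet (h : Antipodal S v u q a b) : ∃ F : Set (E 3),
    IsFacet (convexHull ℝ S) F ∧ StrictlyAntipodal (convexHull ℝ S) {v} F ∧ rho {v} F = 1 := by
  have hu := h.ne_zero
  have hq := h.mem_face.2 ⟨rfl, subset_convexHull ℝ S h.mem_q⟩
  have hs := face_eq_singleton h.mem h.lt
  have hF : IsFace (convexHull ℝ S) (supportHyperplane (convexHull ℝ S) (-u) ∩ convexHull ℝ S) :=
    ⟨-u, neg_ne_zero.2 hu, rfl⟩
  refine ⟨_, ⟨hF, ?_⟩, ⟨⟨u, hu, hs.symm⟩, hF, ?_, u, h.norm_eq, hs, rfl⟩, ?_⟩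
  · rw [affDim, h.vectorSpan_face, Submodule.finrank_orthogonal_span_singleton (n := 2) hu]
  · intro e
    rw [← e, Set.mem_singleton_iff] at hq
    have := h.gap
    simp [hq] at this
  · rw [rho_eq (Set.mem_singleton v) hq hu, h.gap, h.norm_eq]
    · simp
    · rw [h.vectorSpan_face, vectorSpan_singleton, bot_sup_eq]

/-- The facet spans the orthogonal complement of u, and v - q has component one along u; so the hull
has full dimension. -/
theorem isConvexBody (h : Antipodal S v u q a b) (hS : S.Finite) :
    IsConvexBody (convexHull ℝ S) := by
  refine ⟨convex_convexHull ℝ S, hS.isCompact_convexHull ℝ, ?_⟩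
  rw [(convex_convexHull ℝ S).interior_nonempty_iff_affineSpan_eq_top,
    AffineSubspace.affineSpan_eq_top_iff_vectorSpan_eq_top_of_nonempty ℝ _ _
      ⟨v, subset_convexHull ℝ S h.mem⟩, eq_top_iff]
  intro w _
  have h1 : w - inner ℝ u w • (v - q) ∈ (ℝ ∙ u)ᗮ := by
    rw [Submodule.mem_orthogonal_singleton_iff_inner_right, inner_sub_right, real_inner_smul_right,
      h.gap, mul_one, sub_self]
  rw [← h.vectorSpan_face] at h1
  have h2 := vsub_mem_vectorSpan ℝ (subset_convexHull ℝ S h.mem) (subset_convexHull ℝ S h.mem_q)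
  have h3 := add_mem (vectorSpan_mono ℝ Set.inter_subset_right h1)
    (Submodule.smul_mem _ (inner ℝ u w) h2)
  simpa using h3

end Antipodal

/-- A polytope of minimum width one all of whose vertices are strictly antipodal to facets at
distance one is reduced. -/
theorem isReduced_of_antipodal {S : Set (E 3)} (hS : S.Finite) (hne : S.Nonempty)
    (h : ∀ v ∈ S, ∃ u q a b, Antipodal S v u q a b) (hw : minWidth (convexHull ℝ S) = 1) :
    IsReduced (convexHull ℝ S) := by
  obtain ⟨v, hv⟩ := hne
  obtain ⟨u, q, a, b, hA⟩ := h v hv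
  refine isReduced_of_forall_exists (hA.isConvexBody hS) fun w hw' => ?_
  obtain ⟨u, q, a, b, hA⟩ := h w hw'
  exact ⟨u, hA.norm_eq, hA.lt, by rw [hA.width_eq, hw]⟩

theorem setOf_isVertex_eq {S : Set (E 3)} (hS : S.Finite) (hne : S.Nonempty)
    (h : ∀ v ∈ S, ∃ u q a b, Antipodal S v u q a b) :
    {p | IsVertex (convexHull ℝ S) p} = S := by
  ext p
  refine ⟨mem_of_isVertex hS hne, fun hp => ?_⟩
  obtain ⟨u, q, a, b, hA⟩ := h p hp
  exact ⟨u, hA.ne_zero, (face_eq_singleton hA.mem hA.lt).symm⟩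

/-- This describes the vertices in affine terms, which isometries visibly preserve. -/
theorem extremePoints_eq {S : Set (E 3)} (h : ∀ v ∈ S, ∃ u q a b, Antipodal S v u q a b) :
    (convexHull ℝ S).extremePoints ℝ = S := by
  refine extremePoints_convexHull_subset.antisymm fun p hp => ?_
  obtain ⟨u, q, a, b, hA⟩ := h p hp
  exact mem_extremePoints_of_inner_lt hA.mem hA.lt

theorem minWidth_eq_one {S : Set (E 3)} (hS : S.Finite) {v u q a b : E 3}
    (hA : Antipodal S v u q a b) (h : ∀ u : E 3, ‖u‖ ≤ width (convexHull ℝ S) u) :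
    minWidth (convexHull ℝ S) = 1 := by
  refine le_antisymm ?_ (le_csInf ⟨_, u, hA.norm_eq, rfl⟩ ?_)
  · rw [← hA.width_eq]
    exact minWidth_le_width (hS.isCompact_convexHull ℝ) ⟨v, subset_convexHull ℝ S hA.mem⟩ hA.norm_eq
  · rintro _ ⟨w, hw, rfl⟩
    exact hw ▸ h w

/-! ### The width bound on simplicial cones -/

/-- The vectors whose norm is at most the width in their direction. -/
def WidthBound (K : Set (E 3)) (u : E 3) : Prop := ‖u‖ ≤ width K u

/-- The width bound holds on the cone spanned by three vectors. -/
def ConeBound (K : Set (E 3)) (p q r : E 3) : Prop :=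
  ∀ α β γ : ℝ, 0 ≤ α → 0 ≤ β → 0 ≤ γ → WidthBound K (α • p + β • q + γ • r)

namespace ConeBound

variable {K : Set (E 3)} {p q r m : E 3}

/-- The norm is subadditive and ⟪·, x - y⟫ is linear, so the inequality passes from the generators
to nonnegative combinations. -/
theorem of_inner (hK : IsCompact K) {x y : E 3} (hx : x ∈ K) (hy : y ∈ K)
    (hp : ‖p‖ ≤ inner ℝ p (x - y)) (hq : ‖q‖ ≤ inner ℝ q (x - y)) (hr : ‖r‖ ≤ inner ℝ r (x - y)) :
    ConeBound K p q r := by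
  intro α β γ hα hβ hγ
  refine le_trans ?_ (inner_sub_le_width hK _ hx hy)
  refine (norm_add₃_le).trans ?_
  rw [norm_smul, norm_smul, norm_smul, Real.norm_of_nonneg hα, Real.norm_of_nonneg hβ,
    Real.norm_of_nonneg hγ, inner_add_left, inner_add_left, real_inner_smul_left,
    real_inner_smul_left, real_inner_smul_left]
  gcongr

/-- Rotation of the generators. -/
theorem rotate (h : ConeBound K p q r) : ConeBound K q r p := fun α β γ hα hβ hγ => by
  convert! h γ α β hγ hα hβ using 1
  abel

theorem swap (h : ConeBound K p q r) : ConeBound K q p r := fun α β γ hα hβ hγ => by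
  convert! h β α γ hβ hα hγ using 1
  abel

/-- If α/a is the smallest of the ratios α/a, β/b, γ/c, subtracting (α/a) • m leaves nonnegative
coefficients at q and r. In product form the conditions still make sense when b or c vanishes. -/
theorem of_le_of_le {a b c α β γ : ℝ} (h : ConeBound K m q r) (hm : m = a • p + b • q + c • r)
    (ha : 0 < a) (hα : 0 ≤ α) (hβ : α * b ≤ a * β) (hγ : α * c ≤ a * γ) :
    WidthBound K (α • p + β • q + γ • r) := by
  have h1 : α • p + β • q + γ • r = (α / a) • m + (β - α / a * b) • q + (γ - α / a * c) • r := by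
    rw [hm, smul_add, smul_add, smul_smul, smul_smul, smul_smul, div_mul_cancel₀ _ ha.ne',
      sub_smul, sub_smul]
    abel
  rw [h1]
  refine h _ _ _ (div_nonneg hα ha.le) ?_ ?_
  · rw [sub_nonneg, div_mul_eq_mul_div, div_le_iff₀ ha, mul_comm β]
    exact hβ
  · rw [sub_nonneg, div_mul_eq_mul_div, div_le_iff₀ ha, mul_comm γ]
    exact hγ

/-- Subdivision of a cone at a vector in its interior. -/
theorem star {a b c : ℝ} (h₁ : ConeBound K m q r) (h₂ : ConeBound K p m r)
    (h₃ : ConeBound K p q m) (hm : m = a • p + b • q + c • r) (ha : 0 < a) (hb : 0 < b)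
    (hc : 0 < c) : ConeBound K p q r := by
  intro α β γ hα hβ hγ
  have hm₂ : m = b • q + a • p + c • r := by rw [hm]; abel
  have hm₃ : m = c • r + a • p + b • q := by rw [hm]; abel
  have key₁ := h₁.of_le_of_le (β := β) (γ := γ) hm ha hα
  have key₂ := h₂.swap.of_le_of_le (β := α) (γ := γ) hm₂ hb hβ
  have key₃ := h₃.rotate.rotate.of_le_of_le (β := α) (γ := β) hm₃ hc hγ
  rw [add_comm (β • q)] at key₂
  rw [add_assoc, add_comm (γ • r)] at key₃
  -- The subcone containing the vector is the one belonging to the smallest of the three ratios.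
  rcases le_total (α * b) (a * β) with hab | hab
  · rcases le_total (α * c) (a * γ) with hac | hac
    · exact key₁ hab hac
    · refine key₃ (by linarith) ?_
      have : a * (γ * b) ≤ a * (c * β) := by nlinarith
      exact le_of_mul_le_mul_left this ha
  · rcases le_total (β * c) (b * γ) with hbc | hbc
    · exact key₂ (by linarith) hbc
    · refine key₃ ?_ (by linarith)
      have : b * (γ * a) ≤ b * (c * α) := by nlinarith
      exact le_of_mul_le_mul_left this hb

/-- Subdivision of a cone at a vector in the relative interior of a two-dimensional face. -/
theorem bisect {a b : ℝ} (h₁ : ConeBound K m q r) (h₂ : ConeBound K p m r)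
    (hm : m = a • p + b • q) (ha : 0 < a) (hb : 0 < b) : ConeBound K p q r := by
  intro α β γ hα hβ hγ
  have hm₁ : m = a • p + b • q + (0 : ℝ) • r := by rw [hm]; simp
  have hm₂ : m = b • q + a • p + (0 : ℝ) • r := by rw [hm]; simp [add_comm]
  rcases le_total (α * b) (a * β) with h | h
  · exact h₁.of_le_of_le hm₁ ha hα h (by rw [mul_zero]; positivity)
  · have := h₂.swap.of_le_of_le (β := α) (γ := γ) hm₂ hb hβ (by linarith) (by rw [mul_zero]; positivity)
    rwa [add_comm (β • q)] at this

end ConeBound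

end ReducedPolytope

/-! ### The symmetries in D_{2d} and a fundamental cone -/

namespace ReducedPolytope

open Module

/-- The maps `(a, b, c) ↦ (ε a, η b, c)`. -/
noncomputable def flipMap (ε η : ℝ) : E 3 →ₗ[ℝ] E 3 where
  toFun p := !₂[ε * p 0, η * p 1, p 2]
  map_add' p q := by ext i; fin_cases i <;> simp [mul_add]
  map_smul' c p := by ext i; fin_cases i <;> simp [mul_left_comm]

/-- The maps `(a, b, c) ↦ (ε b, η a, -c)`. -/
noncomputable def swapMap (ε η : ℝ) : E 3 →ₗ[ℝ] E 3 where
  toFun p := !₂[ε * p 1, η * p 0, -p 2]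
  map_add' p q := by ext i; fin_cases i <;> simp [mul_add, add_comm]
  map_smul' c p := by ext i; fin_cases i <;> simp [mul_left_comm]

theorem norm_sq_eq (p : E 3) : ‖p‖ ^ 2 = p 0 ^ 2 + p 1 ^ 2 + p 2 ^ 2 := by
  rw [EuclideanSpace.norm_sq_eq, Fin.sum_univ_three]
  simp

theorem inner_eq (p q : E 3) : inner ℝ p q = p 0 * q 0 + p 1 * q 1 + p 2 * q 2 := by
  simp [PiLp.inner_apply, Fin.sum_univ_three, mul_comm]

theorem sq_eq_one_of_eq_or {ε : ℝ} (h : ε = 1 ∨ ε = -1) : ε ^ 2 = 1 := by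
  rcases h with rfl | rfl <;> norm_num

theorem norm_flipMap {ε η : ℝ} (hε : ε = 1 ∨ ε = -1) (hη : η = 1 ∨ η = -1) (p : E 3) :
    ‖flipMap ε η p‖ = ‖p‖ := by
  rw [← sq_eq_sq₀ (norm_nonneg _) (norm_nonneg _), norm_sq_eq, norm_sq_eq]
  simp [flipMap, mul_pow, sq_eq_one_of_eq_or hε, sq_eq_one_of_eq_or hη]

theorem norm_swapMap {ε η : ℝ} (hε : ε = 1 ∨ ε = -1) (hη : η = 1 ∨ η = -1) (p : E 3) :
    ‖swapMap ε η p‖ = ‖p‖ := by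
  rw [← sq_eq_sq₀ (norm_nonneg _) (norm_nonneg _), norm_sq_eq, norm_sq_eq]
  simp [swapMap, mul_pow, sq_eq_one_of_eq_or hε, sq_eq_one_of_eq_or hη, add_comm]

theorem IsD2d.exists_linearIsometryEquiv {f : E 3 → E 3} (hf : IsD2d f) :
    ∃ g : E 3 ≃ₗᵢ[ℝ] E 3, ⇑g = f := by
  obtain ⟨ε, η, hε, hη, h | h⟩ := hf
  · exact ⟨(LinearIsometry.mk (flipMap ε η) (norm_flipMap hε hη)).toLinearIsometryEquiv rfl,
      funext fun p => (h p).symm⟩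
  · exact ⟨(LinearIsometry.mk (swapMap ε η) (norm_swapMap hε hη)).toLinearIsometryEquiv rfl,
      funext fun p => (h p).symm⟩

section Points

variable {t x s h r : ℝ}

/-- Squared coordinates make the set of points visibly invariant under sign changes, without a case
distinction over pairs of indices. -/
theorem mem_range_pts {p : E 3} : p ∈ Set.range (pts t x s h r) ↔
    (p 2 = -t ∧ p 1 = 0 ∧ p 0 ^ 2 = r ^ 2) ∨ (p 2 = t ∧ p 0 = 0 ∧ p 1 ^ 2 = r ^ 2) ∨
    (p 2 = s ∧ p 0 ^ 2 = h ^ 2 ∧ p 1 ^ 2 = x ^ 2) ∨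
    (p 2 = -s ∧ p 0 ^ 2 = x ^ 2 ∧ p 1 ^ 2 = h ^ 2) := by
  have key (i : Fin 12) (h0 : p 0 = pts t x s h r i 0) (h1 : p 1 = pts t x s h r i 1)
      (h2 : p 2 = pts t x s h r i 2) : p ∈ Set.range (pts t x s h r) :=
    ⟨i, by ext j; fin_cases j; exacts [h0.symm, h1.symm, h2.symm]⟩
  simp only [sq_eq_sq_iff_eq_or_eq_neg]
  constructor
  · rintro ⟨i, rfl⟩
    fin_cases i <;> simp [pts]
  · rintro (⟨h2, h1, h0 | h0⟩ | ⟨h2, h0, h1 | h1⟩ | ⟨h2, h0 | h0, h1 | h1⟩ |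
      ⟨h2, h0 | h0, h1 | h1⟩)
    exacts [key 0 h0 h1 h2, key 1 h0 h1 h2, key 2 h0 h1 h2, key 3 h0 h1 h2, key 4 h0 h1 h2,
      key 6 h0 h1 h2, key 5 h0 h1 h2, key 7 h0 h1 h2, key 8 h0 h1 h2, key 9 h0 h1 h2,
      key 10 h0 h1 h2, key 11 h0 h1 h2]

theorem IsD2d.image_range_pts {f : E 3 → E 3} (hf : IsD2d f) :
    f '' Set.range (pts t x s h r) = Set.range (pts t x s h r) := by
  obtain ⟨g, rfl⟩ := hf.exists_linearIsometryEquiv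
  have hsub : g '' Set.range (pts t x s h r) ⊆ Set.range (pts t x s h r) := by
    rintro _ ⟨p, hp, rfl⟩
    rw [mem_range_pts] at hp ⊢
    obtain ⟨ε, η, hε, hη, hg | hg⟩ := hf
    all_goals
      simp [hg, mul_pow, sq_eq_one_of_eq_or hε, sq_eq_one_of_eq_or hη]
      rcases hp with ⟨h2, h1, h0⟩ | ⟨h2, h0, h1⟩ | ⟨h2, h0, h1⟩ | ⟨h2, h0, h1⟩ <;>
        simp [h0, h1, h2]
  refine Set.eq_of_subset_of_ncard_le hsub ?_ (Set.finite_range _)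
  rw [Set.ncard_image_of_injective _ g.injective]

theorem IsD2d.image_convexHull {f : E 3 → E 3} (hf : IsD2d f) :
    f '' convexHull ℝ (Set.range (pts t x s h r)) = convexHull ℝ (Set.range (pts t x s h r)) := by
  obtain ⟨g, rfl⟩ := hf.exists_linearIsometryEquiv
  have := g.toLinearEquiv.toLinearMap.image_convexHull (Set.range (pts t x s h r))
  simp only [LinearEquiv.coe_coe, LinearIsometryEquiv.coe_toLinearEquiv] at this
  rw [this, hf.image_range_pts]

theorem sum_pts : ∑ i, pts t x s h r i = 0 := by
  ext j
  fin_cases j <;> simp [pts, Fin.sum_univ_succ]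

/-- The width bound is invariant under all maps `(a, b, c) ↦ (±a, ±b, ±c)`, `(±b, ±a, ±c)`. -/
theorem WidthBound.of_d2d {f : E 3 → E 3} (hf : IsD2d f) {u : E 3}
    (hu : WidthBound (convexHull ℝ (Set.range (pts t x s h r))) (f u)) :
    WidthBound (convexHull ℝ (Set.range (pts t x s h r))) u := by
  obtain ⟨g, rfl⟩ := hf.exists_linearIsometryEquiv
  rwa [WidthBound, width_image hf.image_convexHull, g.norm_map] at hu

theorem WidthBound.of_neg {K : Set (E 3)} {u : E 3} (hu : WidthBound K (-u)) : WidthBound K u := by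
  rwa [WidthBound, width_neg, norm_neg] at hu

/-- Together with -1 the group D_{2d} generates a group of order 16 containing all sign changes and
the exchange of the first two coordinates. The stated cone is a fundamental domain. -/
theorem widthBound_of_cone
    (hc : ∀ a b c : ℝ, 0 ≤ b → b ≤ a → 0 ≤ c →
      WidthBound (convexHull ℝ (Set.range (pts t x s h r))) !₂[a, b, c]) (u : E 3) :
    WidthBound (convexHull ℝ (Set.range (pts t x s h r))) u := by
  have h1 (a b c : ℝ) (ha : 0 ≤ a) (hb : 0 ≤ b) (hc' : 0 ≤ c) :
      WidthBound (convexHull ℝ (Set.range (pts t x s h r))) !₂[a, b, c] := by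
    rcases le_total b a with hab | hab
    · exact hc a b c hb hab hc'
    -- The element (a, b, c) ↦ (-b, -a, -c), followed by -1, exchanges the first two coordinates and
    -- keeps the third.
    · refine .of_neg (.of_d2d (f := swapMap (-1) (-1))
        ⟨-1, -1, .inr rfl, .inr rfl, .inr fun _ => rfl⟩ ?_)
      convert! hc b a c ha hab hc' using 1
      ext i
      fin_cases i <;> simp [swapMap]
  have h2 (a b c : ℝ) (hc' : 0 ≤ c) :
      WidthBound (convexHull ℝ (Set.range (pts t x s h r))) !₂[a, b, c] := by
    have key (ε η : ℝ) (hε : ε = 1 ∨ ε = -1) (hη : η = 1 ∨ η = -1) (ha : 0 ≤ ε * a)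
        (hb : 0 ≤ η * b) : WidthBound (convexHull ℝ (Set.range (pts t x s h r))) !₂[a, b, c] :=
      .of_d2d (f := flipMap ε η) ⟨ε, η, hε, hη, .inl fun _ => rfl⟩ (h1 _ _ _ ha hb hc')
    rcases le_total 0 a with ha | ha <;> rcases le_total 0 b with hb | hb
    · exact key 1 1 (.inl rfl) (.inl rfl) (by linarith) (by linarith)
    · exact key 1 (-1) (.inl rfl) (.inr rfl) (by linarith) (by linarith)
    · exact key (-1) 1 (.inr rfl) (.inl rfl) (by linarith) (by linarith)
    · exact key (-1) (-1) (.inr rfl) (.inr rfl) (by linarith) (by linarith)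
  have h3 : u = !₂[u 0, u 1, u 2] := by ext i; fin_cases i <;> rfl
  rw [h3]
  rcases le_total 0 (u 2) with hu | hu
  · exact h2 _ _ _ hu
  · refine .of_neg ?_
    convert! h2 (-u 0) (-u 1) (-u 2) (by linarith) using 1
    ext i
    fin_cases i <;> simp

end Points

end ReducedPolytope

/-! ### Facet normals and antipodality of the twelve points -/

namespace ReducedPolytope

open Ex

/-- The twelve points as expressions. -/
def ptsEx : Fin 12 → Fin 3 → Ex :=
  let x := var 0; let s := var 1; let h := var 2; let r := var 3; let t := var 4
  ![![r, 0, 0 - t], ![0 - r, 0, 0 - t], ![0, r, t], ![0, 0 - r, t],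
    ![h, x, s], ![0 - h, x, s], ![h, 0 - x, s], ![0 - h, 0 - x, s],
    ![x, h, 0 - s], ![x, 0 - h, 0 - s], ![0 - x, h, 0 - s], ![0 - x, 0 - h, 0 - s]]

/-- The scalar product of `n` with the difference of two of the points. -/
def dotEx (n : Fin 3 → Ex) (i j : Fin 12) : Ex :=
  n 0 * (ptsEx i 0 - ptsEx j 0) + n 1 * (ptsEx i 1 - ptsEx j 1) + n 2 * (ptsEx i 2 - ptsEx j 2)

/-- The square of the norm. -/
def normSqEx (n : Fin 3 → Ex) : Ex := n 0 * n 0 + n 1 * n 1 + n 2 * n 2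

/-- The vector with the given coordinates. -/
noncomputable def vecEx (z : Fin 7 → ℝ) (n : Fin 3 → Ex) : E 3 := WithLp.toLp 2 fun k => ev z (n k)

theorem vecEx_apply (z : Fin 7 → ℝ) (n : Fin 3 → Ex) (k : Fin 3) :
    vecEx z n k = ev z (n k) := rfl

/-- A normal of the facet opposite to `v₁`, pointing towards `v₁`. -/
def normalOne : Fin 3 → Ex := ![var 1 + var 4, 0, 0 - var 0]

/-- A normal of the facet opposite to `v₅`, pointing towards `v₅`. -/
def normalFive : Fin 3 → Ex :=
  let x := var 0; let s := var 1; let h := var 2; let r := var 3; let t := var 4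
  ![x * (t - s) - h * (s + t), (r - h) * (t - s) - (s + t) * (r - x), h * (r - h) - x * (r - x)]

/-- The cone generators used to bound the width; `coneGen 3` and `coneGen 6` are normals of facets. -/
def coneGen : Fin 8 → Fin 3 → Ex :=
  ![![0, 0, 1], ![602, 602, 524], ![1, 1, 0], ![normalFive 1, normalFive 0, normalFive 2],
    ![1, 0, 0], ![759, 332, 560], ![var 1 + var 4, 0, var 0],
    ![100 * (var 1 + var 4) + 29, 0, 100 * var 0]]

/-- The parameters lie in the box around the numerical solution and solve the system. -/
structure Admissible (x s h r t d₂ d₃ : ℝ) : Prop where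
  box : Box rootMid boxRad ![x, s, h, r, t, d₂, d₃]
  root : ∀ i, ev ![x, s, h, r, t, d₂, d₃] (sys i) = 0

namespace Admissible

variable {x s h r t d₂ d₃ : ℝ}

theorem pos (H : Admissible x s h r t d₂ d₃) (e : Ex) (he : 0 < (encl rootMid boxRad e).1 - (encl rootMid boxRad e).2) :
    0 < ev ![x, s, h, r, t, d₂, d₃] e :=
  ev_pos_of_encl H.box e he

end Admissible

section

variable {x s h r t d₂ d₃ : ℝ}

theorem ev_ptsEx (i : Fin 12) (k : Fin 3) :
    ev ![x, s, h, r, t, d₂, d₃] (ptsEx i k) = pts t x s h r i k := by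
  fin_cases i <;> fin_cases k <;> simp [ptsEx, pts]

theorem inner_vecEx_sub (n : Fin 3 → Ex) (i j : Fin 12) :
    inner ℝ (vecEx ![x, s, h, r, t, d₂, d₃] n) (pts t x s h r i - pts t x s h r j) =
      ev ![x, s, h, r, t, d₂, d₃] (dotEx n i j) := by
  simp only [inner_eq, dotEx, ev_add, ev_mul, ev_sub, ev_ptsEx, vecEx_apply]
  rfl

theorem norm_sq_vecEx (z : Fin 7 → ℝ) (n : Fin 3 → Ex) :
    ‖vecEx z n‖ ^ 2 = ev z (normSqEx n) := by
  simp only [norm_sq_eq, normSqEx, ev_add, ev_mul, vecEx_apply]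
  ring

end

namespace Admissible

variable {x s h r t d₂ d₃ : ℝ}

theorem inner_lt (H : Admissible x s h r t d₂ d₃) (n : Fin 3 → Ex) (i j : Fin 12)
    (he : 0 < (encl rootMid boxRad (dotEx n j i)).1 - (encl rootMid boxRad (dotEx n j i)).2) :
    inner ℝ (vecEx ![x, s, h, r, t, d₂, d₃] n) (pts t x s h r i) <
      inner ℝ (vecEx ![x, s, h, r, t, d₂, d₃] n) (pts t x s h r j) := by
  rw [← sub_pos, ← inner_sub_right, inner_vecEx_sub]
  exact H.pos _ he

/-- A numerical criterion for the width bound at a cone generator. -/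
theorem norm_le_inner (H : Admissible x s h r t d₂ d₃) (n : Fin 3 → Ex) (i j : Fin 12)
    (h₁ : 0 < (encl rootMid boxRad (dotEx n i j)).1 - (encl rootMid boxRad (dotEx n i j)).2)
    (h₂ : 0 < (encl rootMid boxRad (dotEx n i j * dotEx n i j - normSqEx n)).1 -
      (encl rootMid boxRad (dotEx n i j * dotEx n i j - normSqEx n)).2) :
    ‖vecEx ![x, s, h, r, t, d₂, d₃] n‖ ≤
      inner ℝ (vecEx ![x, s, h, r, t, d₂, d₃] n) (pts t x s h r i - pts t x s h r j) := by
  rw [inner_vecEx_sub]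
  refine le_of_sq_le_sq ?_ (H.pos _ h₁).le
  have := H.pos _ h₂
  rw [norm_sq_vecEx]
  simp only [ev_sub, ev_mul] at this
  linarith

/-- The root equations give only the equality of squares; the sign comes from interval arithmetic.
-/
theorem norm_eq_inner (H : Admissible x s h r t d₂ d₃) (n : Fin 3 → Ex) (i j : Fin 12)
    (h₁ : 0 < (encl rootMid boxRad (dotEx n i j)).1 - (encl rootMid boxRad (dotEx n i j)).2)
    (h₂ : ev ![x, s, h, r, t, d₂, d₃] (dotEx n i j * dotEx n i j - normSqEx n) = 0) :
    inner ℝ (vecEx ![x, s, h, r, t, d₂, d₃] n) (pts t x s h r i - pts t x s h r j) =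
      ‖vecEx ![x, s, h, r, t, d₂, d₃] n‖ := by
  rw [inner_vecEx_sub, ← sq_eq_sq₀ (H.pos _ h₁).le (norm_nonneg _), norm_sq_vecEx]
  simp only [ev_sub, ev_mul] at h₂
  linarith

theorem root₁ (H : Admissible x s h r t d₂ d₃) :
    (r * (s + t) + 2 * t * x) ^ 2 = (s + t) ^ 2 + x ^ 2 := by
  have := H.root 0
  simp [sys] at this
  linarith

theorem root₂ (H : Admissible x s h r t d₂ d₃) :
    ((x * (t - s) - h * (s + t)) * (h + r) + ((r - h) * (t - s) - (s + t) * (r - x)) * x +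
      (h * (r - h) - x * (r - x)) * (s + t)) ^ 2 = (x * (t - s) - h * (s + t)) ^ 2 +
      ((r - h) * (t - s) - (s + t) * (r - x)) ^ 2 + (h * (r - h) - x * (r - x)) ^ 2 := by
  have := H.root 1
  simp [sys] at this
  linarith

/-- The facet is v₃v₁₁v₁₂v₄. That its points lie in one plane is a polynomial identity, distance one
is the first root equation, and the position of the other points is numerical. -/
theorem antipodal_one (H : Admissible x s h r t d₂ d₃) : ∃ u q a b,
    Antipodal (Set.range (pts t x s h r)) (pts t x s h r 0) u q a b := by
  have hgap := H.norm_eq_inner normalOne 0 2 (by decide +kernel) (by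
    have := H.root₁
    simp [dotEx, normSqEx, normalOne, ptsEx]
    linear_combination this)
  have hn : 0 < ‖vecEx ![x, s, h, r, t, d₂, d₃] normalOne‖ := by
    rw [← hgap, inner_vecEx_sub]
    exact H.pos _ (by decide +kernel)
  have he (i : Fin 12) (hi : i = 2 ∨ i = 3 ∨ i = 10 ∨ i = 11) :
      inner ℝ (vecEx ![x, s, h, r, t, d₂, d₃] normalOne) (pts t x s h r i) =
        inner ℝ (vecEx ![x, s, h, r, t, d₂, d₃] normalOne) (pts t x s h r 2) := by
    rw [← sub_eq_zero, ← inner_sub_right, inner_vecEx_sub]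
    rcases hi with rfl | rfl | rfl | rfl <;> simp [dotEx, normalOne, ptsEx]
    all_goals ring
  refine ⟨_, pts t x s h r 2, pts t x s h r 10, pts t x s h r 11, Antipodal.of_cross ⟨0, rfl⟩
    ⟨2, rfl⟩ ⟨10, rfl⟩ ⟨11, rfl⟩ ?_ ?_ (he 10 (by simp)) (he 11 (by simp)) ?_ hn hgap⟩
  · rintro _ ⟨i, rfl⟩ hi
    have hd : ∀ i : Fin 12, i ≠ 0 → 0 < (encl rootMid boxRad (dotEx normalOne 0 i)).1 -
      (encl rootMid boxRad (dotEx normalOne 0 i)).2 := by decide +kernel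
    exact H.inner_lt _ _ _ (hd i fun e => hi (e ▸ rfl))
  · rintro _ ⟨i, rfl⟩
    by_cases hi : i = 2 ∨ i = 3 ∨ i = 10 ∨ i = 11
    · exact (he i hi).ge
    · have hd : ∀ i : Fin 12, ¬ (i = 2 ∨ i = 3 ∨ i = 10 ∨ i = 11) →
        0 < (encl rootMid boxRad (dotEx normalOne i 2)).1 -
          (encl rootMid boxRad (dotEx normalOne i 2)).2 := by decide +kernel
      exact (H.inner_lt _ _ _ (hd i hi)).le
  · intro h0
    have h1 := congrArg (fun p : E 3 => p 2) h0
    -- The third coordinate of the cross product is 2hx.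
    have h2 := H.pos (2 * var 2 * var 0) (by decide +kernel)
    simp [cross, cross_apply, pts] at h1
    simp at h2
    nlinarith

theorem antipodal_five (H : Admissible x s h r t d₂ d₃) : ∃ u q a b,
    Antipodal (Set.range (pts t x s h r)) (pts t x s h r 4) u q a b := by
  have hgap := H.norm_eq_inner normalFive 4 1 (by decide +kernel) (by
    have := H.root₂
    simp [dotEx, normSqEx, normalFive, ptsEx]
    linear_combination this)
  have hn : 0 < ‖vecEx ![x, s, h, r, t, d₂, d₃] normalFive‖ := by
    rw [← hgap, inner_vecEx_sub]
    exact H.pos _ (by decide +kernel)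
  have he (i : Fin 12) (hi : i = 1 ∨ i = 7 ∨ i = 11) :
      inner ℝ (vecEx ![x, s, h, r, t, d₂, d₃] normalFive) (pts t x s h r i) =
        inner ℝ (vecEx ![x, s, h, r, t, d₂, d₃] normalFive) (pts t x s h r 1) := by
    rw [← sub_eq_zero, ← inner_sub_right, inner_vecEx_sub]
    rcases hi with rfl | rfl | rfl <;> simp [dotEx, normalFive, ptsEx]
    all_goals ring
  refine ⟨_, pts t x s h r 1, pts t x s h r 7, pts t x s h r 11, Antipodal.of_cross ⟨4, rfl⟩
    ⟨1, rfl⟩ ⟨7, rfl⟩ ⟨11, rfl⟩ ?_ ?_ (he 7 (by simp)) (he 11 (by simp)) ?_ hn hgap⟩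
  · rintro _ ⟨i, rfl⟩ hi
    have hd : ∀ i : Fin 12, i ≠ 4 → 0 < (encl rootMid boxRad (dotEx normalFive 4 i)).1 -
      (encl rootMid boxRad (dotEx normalFive 4 i)).2 := by decide +kernel
    exact H.inner_lt _ _ _ (hd i fun e => hi (e ▸ rfl))
  · rintro _ ⟨i, rfl⟩
    by_cases hi : i = 1 ∨ i = 7 ∨ i = 11
    · exact (he i hi).ge
    · have hd : ∀ i : Fin 12, ¬ (i = 1 ∨ i = 7 ∨ i = 11) →
        0 < (encl rootMid boxRad (dotEx normalFive i 1)).1 -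
          (encl rootMid boxRad (dotEx normalFive i 1)).2 := by decide +kernel
      exact (H.inner_lt _ _ _ (hd i hi)).le
  · intro h0
    have h1 := congrArg (fun p : E 3 => p 2) h0
    have h2 := H.pos (normalFive 2) (by decide +kernel)
    simp [cross, cross_apply, pts] at h1
    simp [normalFive] at h2
    nlinarith

/-- D_{2d} has the two orbits v₁, …, v₄ and v₅, …, v₁₂, so the certificates for v₁ and v₅ can be
transported to all points. -/
theorem antipodal (H : Admissible x s h r t d₂ d₃) :
    ∀ v ∈ Set.range (pts t x s h r), ∃ u q a b,
      Antipodal (Set.range (pts t x s h r)) v u q a b := by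
  have key (f : E 3 → E 3) (hf : IsD2d f) (v w : E 3) (hw : f v = w) (hv : ∃ u q a b,
      Antipodal (Set.range (pts t x s h r)) v u q a b) : ∃ u q a b,
      Antipodal (Set.range (pts t x s h r)) w u q a b := by
    obtain ⟨u, q, a, b, hA⟩ := hv
    subst hw
    obtain ⟨g, rfl⟩ := hf.exists_linearIsometryEquiv
    exact ⟨_, _, _, _, hA.map g hf.image_range_pts⟩
  have hflip (ε η : ℝ) (hε : ε = 1 ∨ ε = -1) (hη : η = 1 ∨ η = -1) := key (flipMap ε η)
    ⟨ε, η, hε, hη, .inl fun _ => rfl⟩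
  have hswap (ε η : ℝ) (hε : ε = 1 ∨ ε = -1) (hη : η = 1 ∨ η = -1) := key (swapMap ε η)
    ⟨ε, η, hε, hη, .inr fun _ => rfl⟩
  have h1 := H.antipodal_one
  have h5 := H.antipodal_five
  have p1 : (1 : ℝ) = 1 ∨ (1 : ℝ) = -1 := .inl rfl
  have m1 : (-1 : ℝ) = 1 ∨ (-1 : ℝ) = -1 := .inr rfl
  rintro _ ⟨i, rfl⟩
  fin_cases i
  · exact h1
  · refine hflip (-1) 1 m1 p1 _ _ ?_ h1
    ext j; fin_cases j <;> simp [flipMap, pts]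
  · refine hswap 1 1 p1 p1 _ _ ?_ h1
    ext j; fin_cases j <;> simp [swapMap, pts]
  · refine hswap 1 (-1) p1 m1 _ _ ?_ h1
    ext j; fin_cases j <;> simp [swapMap, pts]
  · exact h5
  · refine hflip (-1) 1 m1 p1 _ _ ?_ h5
    ext j; fin_cases j <;> simp [flipMap, pts]
  · refine hflip 1 (-1) p1 m1 _ _ ?_ h5
    ext j; fin_cases j <;> simp [flipMap, pts]
  · refine hflip (-1) (-1) m1 m1 _ _ ?_ h5
    ext j; fin_cases j <;> simp [flipMap, pts]
  · refine hswap 1 1 p1 p1 _ _ ?_ h5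
    ext j; fin_cases j <;> simp [swapMap, pts]
  · refine hswap 1 (-1) p1 m1 _ _ ?_ h5
    ext j; fin_cases j <;> simp [swapMap, pts]
  · refine hswap (-1) 1 m1 p1 _ _ ?_ h5
    ext j; fin_cases j <;> simp [swapMap, pts]
  · refine hswap (-1) (-1) m1 m1 _ _ ?_ h5
    ext j; fin_cases j <;> simp [swapMap, pts]

/-- The vector is the outer normal of v₃v₅v₉, the facet opposite to v₁₂. Each of its three vertices
yields a pair for one of the cones meeting at this normal. -/
theorem norm_le_inner_coneGen_three (H : Admissible x s h r t d₂ d₃) (i : Fin 12)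
    (hi : i = 2 ∨ i = 4 ∨ i = 8) :
    ‖vecEx ![x, s, h, r, t, d₂, d₃] (coneGen 3)‖ ≤
      inner ℝ (vecEx ![x, s, h, r, t, d₂, d₃] (coneGen 3))
        (pts t x s h r i - pts t x s h r 11) := by
  have := H.root₂
  rcases hi with rfl | rfl | rfl
  all_goals
    refine (H.norm_eq_inner _ _ _ (by decide +kernel) ?_).ge
    simp [dotEx, normSqEx, coneGen, normalFive, ptsEx]
    linear_combination this

/-- The vector is an outer normal of v₃v₄v₉v₁₀, the facet opposite to v₂. -/
theorem norm_le_inner_coneGen_six (H : Admissible x s h r t d₂ d₃) (i : Fin 12)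
    (hi : i = 2 ∨ i = 8) :
    ‖vecEx ![x, s, h, r, t, d₂, d₃] (coneGen 6)‖ ≤
      inner ℝ (vecEx ![x, s, h, r, t, d₂, d₃] (coneGen 6))
        (pts t x s h r i - pts t x s h r 1) := by
  have := H.root₁
  rcases hi with rfl | rfl
  all_goals
    refine (H.norm_eq_inner _ _ _ (by decide +kernel) ?_).ge
    simp [dotEx, normSqEx, coneGen, ptsEx]
    linear_combination this

end Admissible

end ReducedPolytope

/-! ### The minimum width -/

namespace ReducedPolytope

open Ex

namespace Admissible

variable {x s h r t d₂ d₃ : ℝ}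

/-- Write a, b, c, d, i, f, e, g for generators 0, …, 7. The cone aci is divided at f; then acf at b
on the face ac, bcf at the facet normal d, iaf at the facet normal e on ia, and ief at g on ie. Each
of the eight resulting cones has one pair of points serving all its generators. The integers in b, f
and g are numerical choices that make this work. -/
theorem coneBound (H : Admissible x s h r t d₂ d₃) :
    ConeBound (convexHull ℝ (Set.range (pts t x s h r)))
      (vecEx ![x, s, h, r, t, d₂, d₃] (coneGen 0)) (vecEx ![x, s, h, r, t, d₂, d₃] (coneGen 2))
      (vecEx ![x, s, h, r, t, d₂, d₃] (coneGen 4)) := by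
  have base {p q r' : E 3} (i j : Fin 12) :=
    ConeBound.of_inner (p := p) (q := q) (r := r')
      ((Set.finite_range (pts t x s h r)).isCompact_convexHull ℝ)
      (subset_convexHull ℝ _ ⟨i, rfl⟩) (subset_convexHull ℝ _ ⟨j, rfl⟩)
  have hn (k : Fin 8) (i j : Fin 12) := H.norm_le_inner (coneGen k) i j
  have d₂₁₁ := H.norm_le_inner_coneGen_three 2 (by simp)
  have d₄₁₁ := H.norm_le_inner_coneGen_three 4 (by simp)
  have d₈₁₁ := H.norm_le_inner_coneGen_three 8 (by simp)
  have e₂₁ := H.norm_le_inner_coneGen_six 2 (by simp)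
  have e₈₁ := H.norm_le_inner_coneGen_six 8 (by simp)
  have f₂₁ := hn 5 2 1 (by decide +kernel) (by decide +kernel)
  have f₂₁₁ := hn 5 2 11 (by decide +kernel) (by decide +kernel)
  have f₈₁₁ := hn 5 8 11 (by decide +kernel) (by decide +kernel)
  have f₈₁ := hn 5 8 1 (by decide +kernel) (by decide +kernel)
  have a₂₁ := hn 0 2 1 (by decide +kernel) (by decide +kernel)
  have b₂₁ := hn 1 2 1 (by decide +kernel) (by decide +kernel)
  have b₂₁₁ := hn 1 2 11 (by decide +kernel) (by decide +kernel)
  have b₄₁₁ := hn 1 4 11 (by decide +kernel) (by decide +kernel)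
  have c₄₁₁ := hn 2 4 11 (by decide +kernel) (by decide +kernel)
  have c₈₁₁ := hn 2 8 11 (by decide +kernel) (by decide +kernel)
  have i₈₁₁ := hn 4 8 11 (by decide +kernel) (by decide +kernel)
  have g₈₁ := hn 7 8 1 (by decide +kernel) (by decide +kernel)
  have g₈₁₁ := hn 7 8 11 (by decide +kernel) (by decide +kernel)
  have hst := H.pos (var 1 + var 4) (by decide +kernel)
  have hx := H.pos (var 0) (by decide +kernel)
  -- Up to positive denominators these are the coefficients of generator 3 in terms of generators 5,
  -- 1 and 2, in this order; they show that it lies inside the cone of these three.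
  have p₁ := H.pos (coneGen 3 0 - coneGen 3 1) (by decide +kernel)
  have p₂ := H.pos (427 * coneGen 3 2 - 560 * (coneGen 3 0 - coneGen 3 1)) (by decide +kernel)
  have p₃ := H.pos (524 * 427 * coneGen 3 1 - 602 * (427 * coneGen 3 2
    - 560 * (coneGen 3 0 - coneGen 3 1)) - 332 * 524 * (coneGen 3 0 - coneGen 3 1))
    (by decide +kernel)
  have hgef : ConeBound (convexHull ℝ (Set.range (pts t x s h r)))
      (vecEx ![x, s, h, r, t, d₂, d₃] (coneGen 4)) (vecEx ![x, s, h, r, t, d₂, d₃] (coneGen 6))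
      (vecEx ![x, s, h, r, t, d₂, d₃] (coneGen 5)) := by
    refine ConeBound.bisect (a := 29) (b := 100) (base 8 1 g₈₁ e₈₁ f₈₁) (base 8 11 i₈₁₁ g₈₁₁ f₈₁₁)
      ?_ (by norm_num) (by norm_num)
    ext k
    fin_cases k <;> simp [vecEx, coneGen, add_comm]
  have hiaf : ConeBound (convexHull ℝ (Set.range (pts t x s h r)))
      (vecEx ![x, s, h, r, t, d₂, d₃] (coneGen 4)) (vecEx ![x, s, h, r, t, d₂, d₃] (coneGen 0))
      (vecEx ![x, s, h, r, t, d₂, d₃] (coneGen 5)) := by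
    refine ConeBound.bisect (base 2 1 e₂₁ a₂₁ f₂₁) hgef ?_ hst hx
    ext k
    fin_cases k <;> simp [vecEx, coneGen]
  have hbcf : ConeBound (convexHull ℝ (Set.range (pts t x s h r)))
      (vecEx ![x, s, h, r, t, d₂, d₃] (coneGen 1)) (vecEx ![x, s, h, r, t, d₂, d₃] (coneGen 2))
      (vecEx ![x, s, h, r, t, d₂, d₃] (coneGen 5)) := by
    refine ConeBound.star (base 8 11 d₈₁₁ c₈₁₁ f₈₁₁) (base 2 11 b₂₁₁ d₂₁₁ f₂₁₁)
      (base 4 11 b₄₁₁ c₄₁₁ d₄₁₁) ?_ (div_pos p₂ (by norm_num : (0 : ℝ) < 524 * 427))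
      (div_pos p₃ (by norm_num : (0 : ℝ) < 524 * 427)) (div_pos p₁ (by norm_num : (0 : ℝ) < 427))
    ext k
    fin_cases k <;> simp [vecEx, coneGen] <;> ring
  refine ConeBound.star (base 8 11 f₈₁₁ c₈₁₁ i₈₁₁) hiaf.rotate ?_
    (?_ : _ = (560 : ℝ) • _ + (332 : ℝ) • _ + (427 : ℝ) • _) (by norm_num) (by norm_num)
    (by norm_num)
  · refine ConeBound.bisect hbcf (base 2 1 a₂₁ b₂₁ f₂₁)
      (?_ : _ = (524 : ℝ) • _ + (602 : ℝ) • _) (by norm_num) (by norm_num)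
    ext k
    fin_cases k <;> simp [vecEx, coneGen]
  · ext k
    fin_cases k <;> simp [vecEx, coneGen]
    norm_num

theorem norm_le_width (H : Admissible x s h r t d₂ d₃) (u : E 3) :
    ‖u‖ ≤ width (convexHull ℝ (Set.range (pts t x s h r))) u := by
  refine widthBound_of_cone (fun a b c hb hab hc => ?_) u
  convert! H.coneBound c b (a - b) hc hb (sub_nonneg.2 hab) using 1
  ext k
  fin_cases k <;> simp [vecEx, coneGen]

theorem minWidth_eq (H : Admissible x s h r t d₂ d₃) :
    minWidth (convexHull ℝ (Set.range (pts t x s h r))) = 1 := by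
  obtain ⟨u, q, a, b, hA⟩ := H.antipodal_one
  exact minWidth_eq_one (Set.finite_range _) hA H.norm_le_width

theorem isReduced (H : Admissible x s h r t d₂ d₃) :
    IsReduced (convexHull ℝ (Set.range (pts t x s h r))) :=
  isReduced_of_antipodal (Set.finite_range _) (Set.range_nonempty _) H.antipodal H.minWidth_eq

theorem pts_injective (H : Admissible x s h r t d₂ d₃) : Function.Injective (pts t x s h r) := by
  have hp (i : Fin 4) := H.pos (![var 0 - var 2, var 1, var 2, var 3] i)
    (by revert i; decide +kernel)
  have h0 := hp 0
  have h1 := hp 1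
  have h2 := hp 2
  have h3 := hp 3
  have h4 := H.pos (var 4 - var 1) (by decide +kernel)
  simp at h0 h1 h2 h3 h4
  intro i j hij
  have e0 := congrArg (fun p : E 3 => p 0) hij
  have e1 := congrArg (fun p : E 3 => p 1) hij
  have e2 := congrArg (fun p : E 3 => p 2) hij
  clear hij hp
  fin_cases i <;> fin_cases j <;> simp [pts] at e0 e1 e2 ⊢ <;> linarith

end Admissible

end ReducedPolytope

/-! ### Isometries between members of the family -/

namespace ReducedPolytope

open Ex

/-- A surjective isometry is affine (Mazur–Ulam), so it maps open segments to open segments. -/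
theorem image_extremePoints_isometryEquiv (f : E 3 ≃ᵢ E 3) (A : Set (E 3)) :
    f '' A.extremePoints ℝ = (f '' A).extremePoints ℝ := by
  have hseg (a b : E 3) : f '' openSegment ℝ a b = openSegment ℝ (f a) (f b) := by
    have := image_openSegment ℝ (f.toRealAffineIsometryEquiv.toAffineEquiv.toAffineMap) a b
    simpa using this
  ext b
  obtain ⟨a, rfl⟩ := f.surjective b
  rw [f.injective.mem_set_image, mem_extremePoints, mem_extremePoints, f.injective.mem_set_image]
  simp only [Set.forall_mem_image, ← hseg, f.injective.mem_set_image, f.injective.eq_iff]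

/-- A linear map is determined by its values at three of the points. -/
theorem linearMap_eq_of_eq_pts {t x s h r : ℝ} (hr : r ≠ 0) (ht : t ≠ 0) {L M : E 3 →ₗ[ℝ] E 3}
    (h₀ : L (pts t x s h r 0) = M (pts t x s h r 0))
    (h₁ : L (pts t x s h r 1) = M (pts t x s h r 1))
    (h₂ : L (pts t x s h r 2) = M (pts t x s h r 2)) (p : E 3) : L p = M p := by
  have hp : p = ((p 1 / r - p 2 / t + p 0 / r) / 2) • pts t x s h r 0 +
      ((p 1 / r - p 2 / t - p 0 / r) / 2) • pts t x s h r 1 + (p 1 / r) • pts t x s h r 2 := by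
    ext k
    fin_cases k <;> simp [pts] <;> field_simp <;> ring
  rw [hp]
  simp only [map_add, map_smul, h₀, h₁, h₂]

theorem exists_sign {a r : ℝ} (h : a ^ 2 = r ^ 2) : ∃ ε : ℝ, (ε = 1 ∨ ε = -1) ∧ a = ε * r := by
  rcases sq_eq_sq_iff_eq_or_eq_neg.1 h with rfl | rfl
  · exact ⟨1, .inl rfl, by ring⟩
  · exact ⟨-1, .inr rfl, by ring⟩

namespace Admissible

variable {x s h r t d₂ d₃ x' s' h' r' t' d₂' d₃' : ℝ}

theorem image_range_pts (H : Admissible x s h r t d₂ d₃) (H' : Admissible x' s' h' r' t' d₂' d₃')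
    {f : E 3 ≃ᵢ E 3} (hf : f '' convexHull ℝ (Set.range (pts t x s h r)) =
      convexHull ℝ (Set.range (pts t' x' s' h' r'))) :
    f '' Set.range (pts t x s h r) = Set.range (pts t' x' s' h' r') := by
  rw [← extremePoints_eq H.antipodal, ← extremePoints_eq H'.antipodal,
    image_extremePoints_isometryEquiv, hf]

/-- Both sets of twelve points have centroid 0, and f maps one bijectively to the other. Summing
f(v) = L v + f 0, with L linear, gives 12 f(0) = 0. -/
theorem map_zero (H : Admissible x s h r t d₂ d₃) {f : E 3 ≃ᵢ E 3}
    (hf : f '' Set.range (pts t x s h r) = Set.range (pts t' x' s' h' r')) : f 0 = 0 := by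
  have hσ (i : Fin 12) : ∃ j, pts t' x' s' h' r' j = f (pts t x s h r i) := by
    change _ ∈ Set.range (pts t' x' s' h' r')
    rw [← hf]
    exact ⟨_, ⟨i, rfl⟩, rfl⟩
  choose σ hσ using hσ
  have hinj : Function.Injective σ := fun i j hij => by
    apply H.pts_injective
    apply f.injective
    rw [← hσ, ← hσ, hij]
  have h1 : ∑ i, pts t' x' s' h' r' (σ i) = 0 := by
    rw [(Finite.injective_iff_bijective.1 hinj).sum_comp, sum_pts]
  have h2 (i : Fin 12) : pts t' x' s' h' r' (σ i) =
      f.toRealLinearIsometryEquiv (pts t x s h r i) + f 0 := by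
    rw [hσ, IsometryEquiv.toRealLinearIsometryEquiv_apply, sub_add_cancel]
  simp only [h2, Finset.sum_add_distrib, ← map_sum, sum_pts, _root_.map_zero, zero_add] at h1
  refine (smul_eq_zero.1 (?_ : ((12 : ℕ) : ℝ) • f 0 = 0)).resolve_left (by norm_num)
  rw [Nat.cast_smul_eq_nsmul]
  simpa using h1

/-- The value 0.42 separates the squared norms: r² + t² ≈ 0.428 for v₁, …, v₄ and x² + s² + h² ≈
0.409 for the other points. -/
theorem outer_of_norm_sq (H' : Admissible x' s' h' r' t' d₂' d₃') {w : E 3}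
    (hw : w ∈ Set.range (pts t' x' s' h' r')) (hn : 42 < 100 * ‖w‖ ^ 2) :
    (w 2 = -t' ∧ w 1 = 0 ∧ w 0 ^ 2 = r' ^ 2) ∨ (w 2 = t' ∧ w 0 = 0 ∧ w 1 ^ 2 = r' ^ 2) := by
  have hb := H'.pos (42 - 100 * (var 0 * var 0 + var 1 * var 1 + var 2 * var 2)) (by decide +kernel)
  simp at hb
  rw [norm_sq_eq] at hn
  rcases mem_range_pts.1 hw with hw | hw | ⟨h2, h0, h1⟩ | ⟨h2, h0, h1⟩
  · exact .inl hw
  · exact .inr hw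
  · rw [h0, h1, h2] at hn
    nlinarith
  · rw [h0, h1, h2] at hn
    nlinarith

/-- By the signs of its coordinates v₅ must be one of v₅', …, v₈', and the parameters are its
coordinates up to sign. -/
theorem params_eq (H : Admissible x s h r t d₂ d₃) (H' : Admissible x' s' h' r' t' d₂' d₃')
    (hV : Set.range (pts t x s h r) = Set.range (pts t' x' s' h' r')) :
    x = x' ∧ s = s' ∧ h = h' := by
  have hp (i : Fin 4) := H.pos (var (![0, 1, 2, 4] i)) (by revert i; decide +kernel)
  have hp' (i : Fin 4) := H'.pos (var (![0, 1, 2, 4] i)) (by revert i; decide +kernel)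
  simp [Fin.forall_fin_succ] at hp hp'
  have hm : pts t x s h r 4 ∈ Set.range (pts t' x' s' h' r') := hV ▸ ⟨4, rfl⟩
  rw [mem_range_pts] at hm
  simp [pts] at hm
  rcases hm with ⟨h2, -⟩ | ⟨-, h2, -⟩ | ⟨h2, h0, h1⟩ | ⟨h2, -⟩
  · linarith
  · linarith
  · exact ⟨(sq_eq_sq₀ hp.1.le hp'.1.le).1 h1, h2,
      (sq_eq_sq₀ hp.2.2.1.le hp'.2.2.1.le).1 h0⟩
  · linarith

/-- By their norms, v₁, v₂, v₃ go to points among v₁', …, v₄'. Since t > r, the product ⟪v₁, v₂⟫ =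
t² - r² is positive and ⟪v₁, v₃⟫ = -t² negative, so the images of v₁ and v₂ form one of the pairs
v₁'v₂', v₃'v₄' and that of v₃ belongs to the other. These three points are a basis, so an element of
D_{2d} agrees with f everywhere. -/
theorem isD2d_of_image_eq (H : Admissible x s h r t d₂ d₃)
    (H' : Admissible x' s' h' r' t' d₂' d₃') {f : E 3 ≃ᵢ E 3}
    (hf : f '' Set.range (pts t x s h r) = Set.range (pts t' x' s' h' r')) :
    r = r' ∧ t = t' ∧ IsD2d f := by
  have hL : ⇑(f.toRealLinearIsometryEquivOfMapZero (H.map_zero hf)) = f :=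
    IsometryEquiv.coe_toRealLinearIsometryEquivOfMapZero _ _
  set L := f.toRealLinearIsometryEquivOfMapZero (H.map_zero hf)
  have hr := H.pos (var 3) (by decide +kernel)
  have ht := H.pos (var 4) (by decide +kernel)
  have hr' := H'.pos (var 3) (by decide +kernel)
  have ht' := H'.pos (var 4) (by decide +kernel)
  have hn := H.pos (100 * (var 3 * var 3 + var 4 * var 4) - 42) (by decide +kernel)
  have htr := H.pos (var 4 * var 4 - var 3 * var 3) (by decide +kernel)
  have htr' := H'.pos (var 4 * var 4 - var 3 * var 3) (by decide +kernel)
  simp at hr ht hr' ht' hn htr htr'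
  have hmem (i : Fin 12) : L (pts t x s h r i) ∈ Set.range (pts t' x' s' h' r') := by
    rw [hL, ← hf]
    exact ⟨_, ⟨i, rfl⟩, rfl⟩
  have hnorm (i : Fin 12) (hi : i = 0 ∨ i = 1 ∨ i = 2) :
      ‖L (pts t x s h r i)‖ ^ 2 = r ^ 2 + t ^ 2 := by
    rw [L.norm_map, norm_sq_eq]
    rcases hi with rfl | rfl | rfl <;> simp [pts]
  have hout (i : Fin 12) (hi : i = 0 ∨ i = 1 ∨ i = 2) := H'.outer_of_norm_sq (hmem i)
    (by rw [hnorm i hi]; linarith)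
  have n0 := hnorm 0 (by simp)
  have i01 : inner ℝ (L (pts t x s h r 0)) (L (pts t x s h r 1)) = -r ^ 2 + t ^ 2 := by
    rw [L.inner_map_map, inner_eq]
    simp [pts]
    ring
  have i02 : inner ℝ (L (pts t x s h r 0)) (L (pts t x s h r 2)) = -t ^ 2 := by
    rw [L.inner_map_map, inner_eq]
    simp [pts]
    ring
  have key (g : E 3 →ₗ[ℝ] E 3) (h0 : L (pts t x s h r 0) = g (pts t x s h r 0))
      (h1 : L (pts t x s h r 1) = g (pts t x s h r 1))
      (h2 : L (pts t x s h r 2) = g (pts t x s h r 2)) (p : E 3) : f p = g p := by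
    rw [← hL]
    exact linearMap_eq_of_eq_pts (L := L.toLinearEquiv.toLinearMap) hr.ne' ht.ne' h0 h1 h2 p
  rw [norm_sq_eq] at n0
  rw [inner_eq] at i01 i02
  generalize hw0 : L (pts t x s h r 0) = w0 at *
  generalize hw1 : L (pts t x s h r 1) = w1 at *
  generalize hw2 : L (pts t x s h r 2) = w2 at *
  have o0 := hout 0 (by simp)
  have o1 := hout 1 (by simp)
  have o2 := hout 2 (by simp)
  rw [hw0] at o0
  rw [hw1] at o1
  rw [hw2] at o2
  -- Images of v₁ and v₂ in the same pair are opposite in it, since equal ones would give r = 0;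
  -- comparing norm and inner product yields both parameters.
  have hrt (c c' : ℝ) (hc : c ^ 2 = r' ^ 2) (hc' : c' ^ 2 = r' ^ 2) (hsum : c ^ 2 + t' ^ 2 =
      r ^ 2 + t ^ 2) (hi : c * c' + t' ^ 2 = -r ^ 2 + t ^ 2) : c' = -c ∧ r = r' ∧ t = t' := by
    rw [← hc, sq_eq_sq_iff_eq_or_eq_neg] at hc'
    rcases hc' with rfl | rfl
    · nlinarith
    · exact ⟨rfl, (sq_eq_sq₀ hr.le hr'.le).1 (by linarith), (sq_eq_sq₀ ht.le ht'.le).1 (by linarith)⟩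
  -- Within one pair inner products are t'² ± r'² > 0, whereas ⟪v₁, v₃⟫ < 0.
  have hne (c c' : ℝ) (hc : c ^ 2 = r' ^ 2) (hc' : c' ^ 2 = r' ^ 2)
      (hi : c * c' + t' ^ 2 = -t ^ 2) : False := by
    rw [← hc, sq_eq_sq_iff_eq_or_eq_neg] at hc'
    rcases hc' with rfl | rfl <;> nlinarith
  rcases o0 with ⟨a2, a1, a0⟩ | ⟨a2, a0, a1⟩
  · rcases o1 with ⟨b2, b1, b0⟩ | ⟨b2, b0, b1⟩
    · obtain ⟨hb, rfl, rfl⟩ := hrt _ _ a0 b0 (by rw [a1, a2] at n0; linarith)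
        (by rw [a1, a2, b1, b2] at i01; linarith)
      rcases o2 with ⟨c2, c1, c0⟩ | ⟨c2, c0, c1⟩
      · exact (hne _ _ a0 c0 (by rw [a1, a2, c1, c2] at i02; linarith)).elim
      · obtain ⟨ε, hε, ha⟩ := exists_sign a0
        obtain ⟨η, hη, hc⟩ := exists_sign c1
        refine ⟨rfl, rfl, ε, η, hε, hη, .inl (key (flipMap ε η) ?_ ?_ ?_)⟩ <;> ext k <;>
          fin_cases k <;> simp [flipMap, pts, ha, hb, hc, a1, a2, b1, b2, c0, c2]
    · rw [a1, a2, b0, b2] at i01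
      nlinarith
  · rcases o1 with ⟨b2, b1, b0⟩ | ⟨b2, b0, b1⟩
    · rw [a0, a2, b1, b2] at i01
      nlinarith
    · obtain ⟨hb, rfl, rfl⟩ := hrt _ _ a1 b1 (by rw [a0, a2] at n0; linarith)
        (by rw [a0, a2, b0, b2] at i01; linarith)
      rcases o2 with ⟨c2, c1, c0⟩ | ⟨c2, c0, c1⟩
      · obtain ⟨ε, hε, hc⟩ := exists_sign c0
        obtain ⟨η, hη, ha⟩ := exists_sign a1
        refine ⟨rfl, rfl, ε, η, hε, hη, .inr (key (swapMap ε η) ?_ ?_ ?_)⟩ <;> ext k <;>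
          fin_cases k <;> simp [swapMap, pts, ha, hb, hc, a0, a2, b0, b2, c1, c2]
      · exact (hne _ _ a1 c1 (by rw [a0, a2, c0, c2] at i02; linarith)).elim

theorem image_eq_iff_isD2d (H : Admissible x s h r t d₂ d₃) (f : E 3 ≃ᵢ E 3) :
    f '' convexHull ℝ (Set.range (pts t x s h r)) = convexHull ℝ (Set.range (pts t x s h r)) ↔
      IsD2d f :=
  ⟨fun hf => (H.isD2d_of_image_eq H (H.image_range_pts H hf)).2.2, fun hf => hf.image_convexHull⟩

/-- The isometry lies in D_{2d}, so it preserves the first vertex set; hence the two vertex sets are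
equal. -/
theorem params_eq_of_congruent (H : Admissible x s h r t d₂ d₃)
    (H' : Admissible x' s' h' r' t' d₂' d₃') (hC : Congruent
      (convexHull ℝ (Set.range (pts t x s h r))) (convexHull ℝ (Set.range (pts t' x' s' h' r')))) :
    x = x' ∧ s = s' ∧ h = h' ∧ r = r' ∧ t = t' := by
  obtain ⟨f, hf⟩ := hC
  have hV := H.image_range_pts H' hf
  obtain ⟨hr, ht, hD⟩ := H.isD2d_of_image_eq H' hV
  rw [hD.image_range_pts] at hV
  obtain ⟨h1, h2, h3⟩ := H.params_eq H' hV
  exact ⟨h1, h2, h3, hr, ht⟩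

end Admissible

end ReducedPolytope

/-! ### The given form of the system and the prescribed distances -/

namespace ReducedPolytope

open Ex

section Coordinates

variable (δ : Fin 3 → ℝ) (y : Fin 4 → ℝ)

theorem v_one : v δ y 1 = !₂[y 3, 0, -(δ 0 / 2)] := rfl
theorem v_two : v δ y 2 = !₂[-y 3, 0, -(δ 0 / 2)] := rfl
theorem v_three : v δ y 3 = !₂[0, y 3, δ 0 / 2] := rfl
theorem v_four : v δ y 4 = !₂[0, -y 3, δ 0 / 2] := rfl
theorem v_five : v δ y 5 = !₂[y 2, y 0, y 1] := rfl
theorem v_eight : v δ y 8 = !₂[-y 2, -y 0, y 1] := rfl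
theorem v_nine : v δ y 9 = !₂[y 0, y 2, -y 1] := rfl
theorem v_eleven : v δ y 11 = !₂[-y 0, y 2, -y 1] := rfl
theorem v_twelve : v δ y 12 = !₂[-y 0, -y 2, -y 1] := rfl

theorem image_v : v δ y '' Set.Icc 1 12 = Set.range (pts (δ 0 / 2) (y 0) (y 1) (y 2) (y 3)) := by
  ext p
  constructor
  · rintro ⟨k, -, rfl⟩
    exact ⟨_, rfl⟩
  · rintro ⟨i, rfl⟩
    refine ⟨i + 1, ⟨by omega, by omega⟩, ?_⟩
    simp [v]

theorem injOn_v (h : Function.Injective (pts (δ 0 / 2) (y 0) (y 1) (y 2) (y 3))) :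
    Set.InjOn (v δ y) (Set.Icc 1 12) := by
  rintro k ⟨hk, hk'⟩ l ⟨hl, hl'⟩ hkl
  have := congrArg Fin.val (h hkl)
  simp only [Fin.ofNat] at this
  omega

theorem isSystem_sysPoly : IsSystem δ (sysPoly δ) := by
  constructor <;> intro y <;> rw [sysPoly, eval_toMv, inner_eq, norm_sq_eq]
  · simp [sys, env, n₁, cross, cross_apply, v_one, v_three, v_eleven, v_twelve]
    ring
  · simp [sys, env, n₂, cross, cross_apply, v_two, v_five, v_eight, v_twelve]
    ring
  · simp [sys, env, n₅, cross, cross_apply, v_one, v_four, v_eight, v_nine]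
    ring
  · simp [sys, env, n₄, cross, cross_apply, v_one, v_four, v_five, v_eight]
    ring

end Coordinates

/-- The distance of two affine subspaces of `ℝ³` in terms of a cross product. -/
theorem rho_eq_of_cross {A B : Set (E 3)} {p q a b : E 3} {d : ℝ} (hp : p ∈ A) (hq : q ∈ B)
    (hA : ∀ x ∈ A, inner ℝ (cross a b) x = inner ℝ (cross a b) p)
    (hB : ∀ x ∈ B, inner ℝ (cross a b) x = inner ℝ (cross a b) q)
    (ha : a ∈ vectorSpan ℝ A ⊔ vectorSpan ℝ B) (hb : b ∈ vectorSpan ℝ A ⊔ vectorSpan ℝ B)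
    (hn : cross a b ≠ 0) (hd : 0 ≤ d)
    (h : inner ℝ (cross a b) (p - q) ^ 2 - d ^ 2 * ‖cross a b‖ ^ 2 = 0) : rho A B = d := by
  rw [rho_eq hp hq hn (eq_orthogonal_of_linearIndependent hn
    (sup_le (inner_eq_zero_of_mem_vectorSpan hA) (inner_eq_zero_of_mem_vectorSpan hB)) ha hb
    (linearIndependent_of_cross_ne_zero hn)), div_eq_iff (norm_ne_zero_iff.2 hn),
    ← abs_of_nonneg (mul_nonneg hd (norm_nonneg (cross a b))), ← sq_eq_sq_iff_abs_eq_abs, mul_pow]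
  linarith

theorem rho_edges {p p' q q' : E 3} {d : ℝ} (hn : cross (p - p') (q - q') ≠ 0) (hd : 0 ≤ d)
    (h : inner ℝ (cross (p - p') (q - q')) (p - q) ^ 2
      - d ^ 2 * ‖cross (p - p') (q - q')‖ ^ 2 = 0) : rho {p, p'} {q, q'} = d := by
  have h1 := cross_inner_left (p - p') (q - q')
  have h2 := cross_inner_right (p - p') (q - q')
  rw [inner_sub_right, sub_eq_zero] at h1 h2
  refine rho_eq_of_cross (Set.mem_insert _ _) (Set.mem_insert _ _) ?_ ?_
    (Submodule.mem_sup_left (vsub_mem_vectorSpan ℝ (by simp) (by simp)))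
    (Submodule.mem_sup_right (vsub_mem_vectorSpan ℝ (by simp) (by simp))) hn hd h
  · rintro x (rfl | rfl)
    exacts [rfl, h1.symm]
  · rintro x (rfl | rfl)
    exacts [rfl, h2.symm]

theorem rho_vertex {B : Set (E 3)} {p q a b : E 3} (hq : q ∈ B) (ha : a ∈ B) (hb : b ∈ B)
    (hB : ∀ x ∈ B, inner ℝ (cross (a - q) (b - q)) x = inner ℝ (cross (a - q) (b - q)) q)
    (hn : cross (a - q) (b - q) ≠ 0)
    (h : inner ℝ (cross (a - q) (b - q)) (p - q) ^ 2 - ‖cross (a - q) (b - q)‖ ^ 2 = 0) :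
    rho {p} B = 1 :=
  rho_eq_of_cross (Set.mem_singleton _) hq (by simp) hB
    (Submodule.mem_sup_right (vsub_mem_vectorSpan ℝ ha hq))
    (Submodule.mem_sup_right (vsub_mem_vectorSpan ℝ hb hq)) hn zero_le_one
    (by rwa [one_pow, one_mul])

theorem ne_zero_of_apply_ne_zero {p : E 3} (k : Fin 3) (h : p k ≠ 0) : p ≠ 0 := by
  rintro rfl
  exact h rfl

section Distances

variable {δ : Fin 3 → ℝ} {y : Fin 4 → ℝ}

theorem rho_vertex_one (H : Admissible (y 0) (y 1) (y 2) (y 3) (δ 0 / 2) (δ 1) (δ 2)) :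
    rho {v δ y 1} {v δ y 3, v δ y 11, v δ y 12, v δ y 4} = 1 := by
  have hz := H.pos (2 * var 2 * var 0) (by decide +kernel)
  have he := (isSystem_sysPoly δ).eq₁ y
  rw [sysPoly, eval_toMv, env, H.root, mul_zero] at he
  have h1 := cross_inner_left (v δ y 11 - v δ y 3) (v δ y 12 - v δ y 3)
  have h2 := cross_inner_right (v δ y 11 - v δ y 3) (v δ y 12 - v δ y 3)
  rw [inner_sub_right, sub_eq_zero] at h1 h2
  refine rho_vertex (q := v δ y 3) (a := v δ y 11) (b := v δ y 12) (by simp) (by simp) (by simp)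
    ?_ (ne_zero_of_apply_ne_zero 2 ?_) he.symm
  · rintro x (rfl | rfl | rfl | rfl)
    · rfl
    · exact h1
    · exact h2
    · rw [inner_eq, inner_eq]
      simp [cross, cross_apply, v_three, v_four, v_eleven, v_twelve]
      ring
  · refine ne_of_gt (lt_of_lt_of_eq hz ?_)
    simp [cross, cross_apply, v_three, v_eleven, v_twelve]
    ring

theorem rho_vertex_five (H : Admissible (y 0) (y 1) (y 2) (y 3) (δ 0 / 2) (δ 1) (δ 2)) :
    rho {v δ y 5} {v δ y 2, v δ y 8, v δ y 12} = 1 := by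
  have hz := H.pos (normalFive 2) (by decide +kernel)
  have he := (isSystem_sysPoly δ).eq₂ y
  rw [sysPoly, eval_toMv, env, H.root] at he
  have h1 := cross_inner_left (v δ y 8 - v δ y 2) (v δ y 12 - v δ y 2)
  have h2 := cross_inner_right (v δ y 8 - v δ y 2) (v δ y 12 - v δ y 2)
  rw [inner_sub_right, sub_eq_zero] at h1 h2
  refine rho_vertex (q := v δ y 2) (a := v δ y 8) (b := v δ y 12) (by simp) (by simp) (by simp)
    ?_ (ne_zero_of_apply_ne_zero 2 ?_) he.symm
  · rintro x (rfl | rfl | rfl)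
    · rfl
    · exact h1
    · exact h2
  · refine ne_of_lt (neg_pos.1 (lt_of_lt_of_eq hz ?_))
    simp [cross, cross_apply, v_two, v_eight, v_twelve, normalFive]
    ring

theorem rho_edge_one (H : Admissible (y 0) (y 1) (y 2) (y 3) (δ 0 / 2) (δ 1) (δ 2)) :
    rho {v δ y 1, v δ y 2} {v δ y 3, v δ y 4} = δ 0 := by
  have hz := H.pos (4 * var 3 * var 3) (by decide +kernel)
  have ht := H.pos (2 * var 4) (by decide +kernel)
  simp at ht
  refine rho_edges (ne_zero_of_apply_ne_zero 2 ?_) ht.le ?_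
  · refine ne_of_gt (lt_of_lt_of_eq hz ?_)
    simp [cross, cross_apply, v_one, v_two, v_three, v_four]
    ring
  · rw [inner_eq, norm_sq_eq]
    simp [cross, cross_apply, v_one, v_two, v_three, v_four]
    ring

theorem rho_edge_two (H : Admissible (y 0) (y 1) (y 2) (y 3) (δ 0 / 2) (δ 1) (δ 2)) :
    rho {v δ y 1, v δ y 5} {v δ y 4, v δ y 8} = δ 1 := by
  have hz := H.pos ((var 3 - var 2) * (var 0 - var 3) + var 0 * var 2) (by decide +kernel)
  have hd := H.pos (var 5) (by decide +kernel)
  have he := (isSystem_sysPoly δ).eq₄ y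
  rw [sysPoly, eval_toMv, env, H.root] at he
  refine rho_edges (ne_zero_of_apply_ne_zero 2 ?_) hd.le he.symm
  refine ne_of_gt (lt_of_lt_of_eq hz ?_)
  simp [cross, cross_apply, v_one, v_four, v_five, v_eight, -mul_eq_mul_left_iff]
  ring

theorem rho_edge_three (H : Admissible (y 0) (y 1) (y 2) (y 3) (δ 0 / 2) (δ 1) (δ 2)) :
    rho {v δ y 1, v δ y 9} {v δ y 4, v δ y 8} = δ 2 := by
  -- This is the first coordinate of n₅; its positivity also shows that the factor h + r - x divided
  -- out does not vanish.
  have hz := H.pos ((var 0 - var 2 - var 3) * (var 4 - var 1)) (by decide +kernel)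
  have hd := H.pos (var 6) (by decide +kernel)
  have he := (isSystem_sysPoly δ).eq₃ y
  rw [sysPoly, eval_toMv, env, H.root, mul_zero] at he
  refine rho_edges (ne_zero_of_apply_ne_zero 0 ?_) hd.le he.symm
  refine ne_of_gt (lt_of_lt_of_eq hz ?_)
  simp [cross, cross_apply, v_one, v_four, v_eight, v_nine]
  ring

end Distances

end ReducedPolytope

/-! ### The main theorem -/

theorem mainTheorem1 :
    -- there are reduced polytopes in three-dimensional Euclidean space
    (∃ P : Set (ReducedPolytope.E 3),
      ReducedPolytope.IsPolytope P ∧ ReducedPolytope.IsReduced P) ∧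
    -- the four left-hand sides are polynomials of degree at most six
    ∃ q : (Fin 3 → ℝ) → Fin 4 → MvPolynomial (Fin 4) ℝ,
      (∀ δ, ReducedPolytope.IsSystem δ (q δ)) ∧
      (∀ δ i, (q δ i).totalDegree ≤ 6) ∧
      -- a smooth family of roots over a neighbourhood of `δ₀`
      ∃ (U : Set (Fin 3 → ℝ)) (φ : (Fin 3 → ℝ) → (Fin 4 → ℝ)),
        IsOpen U ∧ ReducedPolytope.δ₀ ∈ U ∧ ContDiffOn ℝ ∞ φ U ∧
        -- at `δ₀` the root is next to the numerical solution, and non-degenerate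
        (∀ i, |φ ReducedPolytope.δ₀ i - ReducedPolytope.yNum i| ≤ 1 / 10 ^ 13) ∧
        (Matrix.of fun i j : Fin 4 => MvPolynomial.eval (φ ReducedPolytope.δ₀)
          (MvPolynomial.pderiv j (q ReducedPolytope.δ₀ i))).det ≠ 0 ∧
        (∀ δ ∈ U,
          -- exact root, with positive parameters
          (∀ i, MvPolynomial.eval (φ δ) (q δ i) = 0) ∧
          0 < δ 0 / 2 ∧ (∀ i, 0 < φ δ i) ∧
          -- the distances prescribed by the equations
          ReducedPolytope.rho {ReducedPolytope.v δ (φ δ) 1}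
            {ReducedPolytope.v δ (φ δ) 3, ReducedPolytope.v δ (φ δ) 11,
              ReducedPolytope.v δ (φ δ) 12, ReducedPolytope.v δ (φ δ) 4} = 1 ∧
          ReducedPolytope.rho {ReducedPolytope.v δ (φ δ) 5}
            {ReducedPolytope.v δ (φ δ) 2, ReducedPolytope.v δ (φ δ) 8,
              ReducedPolytope.v δ (φ δ) 12} = 1 ∧
          ReducedPolytope.rho {ReducedPolytope.v δ (φ δ) 1, ReducedPolytope.v δ (φ δ) 2}
            {ReducedPolytope.v δ (φ δ) 3, ReducedPolytope.v δ (φ δ) 4} = δ 0 ∧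
          ReducedPolytope.rho {ReducedPolytope.v δ (φ δ) 1, ReducedPolytope.v δ (φ δ) 5}
            {ReducedPolytope.v δ (φ δ) 4, ReducedPolytope.v δ (φ δ) 8} = δ 1 ∧
          ReducedPolytope.rho {ReducedPolytope.v δ (φ δ) 1, ReducedPolytope.v δ (φ δ) 9}
            {ReducedPolytope.v δ (φ δ) 4, ReducedPolytope.v δ (φ δ) 8} = δ 2 ∧
          -- `v₁, …, v₁₂` are twelve distinct points and exactly the vertices of the polytope
          Set.InjOn (ReducedPolytope.v δ (φ δ)) (Set.Icc 1 12) ∧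
          {p | ReducedPolytope.IsVertex (ReducedPolytope.poly δ (φ δ)) p} =
            ReducedPolytope.v δ (φ δ) '' Set.Icc 1 12 ∧
          -- its symmetry group
          (∀ f : ReducedPolytope.E 3 ≃ᵢ ReducedPolytope.E 3,
            f '' ReducedPolytope.poly δ (φ δ) = ReducedPolytope.poly δ (φ δ) ↔
              ReducedPolytope.IsD2d f) ∧
          -- its minimum width is one, each vertex has a strictly antipodal facet at distance one,
          -- and it is reduced
          ReducedPolytope.minWidth (ReducedPolytope.poly δ (φ δ)) = 1 ∧
          (∀ k ∈ Set.Icc 1 12, ∃ F : Set (ReducedPolytope.E 3),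
            ReducedPolytope.IsFacet (ReducedPolytope.poly δ (φ δ)) F ∧
            ReducedPolytope.StrictlyAntipodal (ReducedPolytope.poly δ (φ δ))
              {ReducedPolytope.v δ (φ δ) k} F ∧
            ReducedPolytope.rho {ReducedPolytope.v δ (φ δ) k} F = 1) ∧
          ReducedPolytope.IsReduced (ReducedPolytope.poly δ (φ δ))) ∧
        -- three degrees of freedom: different values of `δ` give non-congruent polytopes
        (∀ δ ∈ U, ∀ δ' ∈ U,
          ReducedPolytope.Congruent (ReducedPolytope.poly δ (φ δ))
            (ReducedPolytope.poly δ' (φ δ')) → δ = δ') := by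
  obtain ⟨U, φ, hUo, hU₀, hφ, hφ₀, hU⟩ := ReducedPolytope.exists_smooth_root
  have hA (δ) (hδ : δ ∈ U) : ReducedPolytope.Admissible (φ δ 0) (φ δ 1) (φ δ 2) (φ δ 3) (δ 0 / 2)
      (δ 1) (δ 2) := ⟨(hU δ hδ).2, (hU δ hδ).1⟩
  have hpoly (δ : Fin 3 → ℝ) (y : Fin 4 → ℝ) : ReducedPolytope.poly δ y = convexHull ℝ
      (Set.range (ReducedPolytope.pts (δ 0 / 2) (y 0) (y 1) (y 2) (y 3))) := by
    rw [ReducedPolytope.poly, ReducedPolytope.image_v]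
  have hred (δ) (hδ : δ ∈ U) : ReducedPolytope.IsReduced (ReducedPolytope.poly δ (φ δ)) := by
    rw [hpoly]
    exact (hA δ hδ).isReduced
  refine ⟨⟨_, ⟨_, (Set.finite_Icc 1 12).image _, rfl⟩, hred _ hU₀⟩, ReducedPolytope.sysPoly,
    ReducedPolytope.isSystem_sysPoly, fun δ i => (ReducedPolytope.Ex.totalDegree_toMv_le _ _).trans
    (ReducedPolytope.deg_sys_le i), U, φ, hUo, hU₀, hφ, fun i => ?_, ?_, fun δ hδ => ?_,
    fun δ hδ δ' hδ' hC => ?_⟩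
  · have h : |φ ReducedPolytope.δ₀ i - ReducedPolytope.rootApprox i| ≤ 1 / 10 ^ 14 :=
      (dist_le_pi_dist _ _ i).trans hφ₀
    rw [abs_le] at h ⊢
    fin_cases i <;> simp [ReducedPolytope.rootApprox, ReducedPolytope.yNum] at h ⊢ <;>
      constructor <;> linarith
  · convert! ReducedPolytope.det_jac_ne_zero hφ₀ using 2
    ext i j
    simp only [ReducedPolytope.jac, Matrix.of_apply, ReducedPolytope.sysPoly,
      ReducedPolytope.Ex.pderiv_toMv, ReducedPolytope.Ex.eval_toMv]
  · have H := hA δ hδ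
    have hV := ReducedPolytope.image_v δ (φ δ)
    have hant := H.antipodal
    refine ⟨fun i => ?_, H.pos (.var 4) (by decide +kernel), fun i => ?_,
      ReducedPolytope.rho_vertex_one H, ReducedPolytope.rho_vertex_five H,
      ReducedPolytope.rho_edge_one H, ReducedPolytope.rho_edge_two H,
      ReducedPolytope.rho_edge_three H, ReducedPolytope.injOn_v _ _ H.pts_injective, ?_,
      fun f => ?_, ?_, fun k hk => ?_, hred δ hδ⟩
    · rw [ReducedPolytope.sysPoly, ReducedPolytope.Ex.eval_toMv]
      exact (hU δ hδ).1 i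
    · have := H.pos (.var (i.castLE (by norm_num))) (by revert i; decide +kernel)
      fin_cases i <;> exact this
    · rw [hpoly, hV]
      exact ReducedPolytope.setOf_isVertex_eq (Set.finite_range _) (Set.range_nonempty _) hant
    · rw [hpoly]
      exact H.image_eq_iff_isD2d f
    · rw [hpoly]
      exact H.minWidth_eq
    · obtain ⟨u, q, a, b, h⟩ := hant _ (hV ▸ Set.mem_image_of_mem _ hk)
      rw [hpoly]
      exact h.exists_facet
  · rw [hpoly, hpoly] at hC
    obtain ⟨h0, h1, h2, h3, ht⟩ := (hA δ hδ).params_eq_of_congruent (hA δ' hδ') hC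
    -- Congruence yields equal t and equal points vₖ: t determines δ₁, while δ₂ and δ₃ are distances
    -- between affine hulls of these points.
    have hv (k : ℕ) : ReducedPolytope.v δ (φ δ) k = ReducedPolytope.v δ' (φ δ') k := by
      rw [ReducedPolytope.v, ReducedPolytope.v, h0, h1, h2, h3, ht]
    ext i
    fin_cases i
    · change δ 0 = δ' 0
      linarith
    · change δ 1 = δ' 1
      rw [← ReducedPolytope.rho_edge_two (hA δ hδ), ← ReducedPolytope.rho_edge_two (hA δ' hδ')]
      simp only [hv]
    · change δ 2 = δ' 2
      rw [← ReducedPolytope.rho_edge_three (hA δ hδ), ← ReducedPolytope.rho_edge_three (hA δ' hδ')]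
      simp only [hv]
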